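/- **Theorem.** Let $G=(V,E)$ be a finite connected simple graph with $n=|V|$, $m=|E|$ and maximum degree $\Delta\le 3$. Consider a pairwise binary graphical model on $G$ with nonnegative factors $\psi_v(x_v)$, $\psi_{u,v}(x_u,x_v)=\psi_{v,u}(x_v,x_u)$, $x\in\{0,1\}^V$, and let nonnegative messages $m_{u\to v}$ be a fixed point of belief propagation, i.e. $m_{u\to v}(x_v)\propto\sum_{x_u}\psi_{u,v}(x_u,x_v)\psi_u(x_u)\prod_{w\in N(u)\setminus v}m_{w\to u}(x_u)$ (with a positive constant). Let $\tau_v(x_v)\propto\psi_v(x_v)\prod_{u\in N(v)}m_{u\to v}(x_v)$ and $\tau_{u,v}(x_u,x_v)\propto\psi_u(x_u)\psi_v(x_v)\psi_{u,v}(x_u,x_v)\prod_{w\in N(u)\setminus v}m_{w\to u}(x_u)\prod_{w\in N(v)\setminus u}m_{w\to v}(x_v)$ be the normalized beliefs, and assume $0<\tau_v(1)<1$ for all $v$. Identify a subgraph $F$ with its set of edges, let $d_F(v)$ be the degree of $v$ in $F$ and $V_F$ the set of vertices with $d_F(v)>0$, and put $$w(F)=\prod_{(u,v)\in F}\Big(\tfrac{\tau_{u,v}(1,1)}{\tau_u(1)\tau_v(1)}-1\Big)\prod_{v\in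 V_F}\Big(\tau_v(1)+(-1)^{d_F(v)}\Big(\tfrac{\tau_v(1)}{1-\tau_v(1)}\Big)^{d_F(v)-1}\tau_v(1)\Big).$$ Let $\mathcal L_{\text{2-Loop}}$ be the set of $F$ (including $\emptyset$) with $d_F(v)=2$ for all $v\in V_F$, let $\mathcal L_{\text{2-Odd}}$ be the set of $F$ with exactly two vertices of odd degree, and let $\pi_{\text{2-Loop}}(F)=|w(F)|/\sum_{F'\in\mathcal L_{\text{2-Loop}}}|w(F')|$ for $F\in\mathcal L_{\text{2-Loop}}$. For $F\in\mathcal L_{\text{2-Odd}}$ redefine $w(F)=\prod_{e\in F}w(e)$, where $w(e)=\Big|\frac{\tau_{u,v}(1,1)-\tau_u(1)\tau_v(1)}{\sqrt{\tau_u(1)\tau_v(1)(1-\tau_u(1))(1-\tau_v(1))}}\Big|$ for $e=\{u,v\}$. One iteration of the *Worm chain* on $\mathcal L_{\text{2-Loop}}\cup\mathcal L_{\text{2-Odd}}$ goes from $F$ to $F'$ as follows. If $F\in\mathcal L_{\text{2-Loop}}$, pick $v$ uniformly from $V$; otherwise pick $v$ uniformly from the two odd-degree vertices of $F$. Pick a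 uniformly random neighbor $u$ of $v$ in $G$ (if $n=1$ there is none, and $F'=F$). With probability $$\begin{cases}\min\big(\frac1n\frac{|w(F\oplus\{u,v\})|}{|w(F)|},\frac12\big)&\text{if }F\in\mathcal L_{\text{2-Loop}},\\ \min\big(\frac n4\frac{|w(F\oplus\{u,v\})|}{|w(F)|},\frac12\big)&\text{else if }F\oplus\{u,v\}\in\mathcal L_{\text{2-Loop}},\\ \min\big(\frac{d(v)}{2d(u)}\frac{|w(F\oplus\{u,v\})|}{|w(F)|},\frac12\big)&\text{else if }F,F\oplus\{u,v\}\in\mathcal L_{\text{2-Odd}}\end{cases}$$ set $F'=F\oplus\{u,v\}$ (symmetric difference with the edge $\{u,v\}$; $d$ is the degree in $G$), and otherwise $F'=F$. The *sampler* performs at most $N$ independent trials. Each trial starts from $F=\emptyset$ and runs $T$ iterations of the Worm chain; the final state of the first trial that ends in $\mathcal L_{\text{2-Loop}}$ is output. If all $N$ trials fail, $\emptyset$ is output. Let $\delta>0$ and let $N,T$ be nonnegative integers with $$N\ge 1.2\,n\log(3\delta^{-1}),\qquad T\ge (m-n+1)\log 2+4\Delta mn^4\log(3n\delta^{-1}).$$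 Then $$\frac12\sum_{F\in\mathcal L_{\text{2-Loop}}}\Big|P[\text{the sampler outputs }F]-\pi_{\text{2-Loop}}(F)\Big|\le\delta .$$ -/

import Mathlib

open scoped symmDiff

/-- A pairwise binary Markov random field on the graph `G`: nonnegative factors `ψ_v(x_v)` on the
vertices and `ψ_{u,v}(x_u, x_v)` on the edges.  An edge factor belongs to the unordered edge, hence
`ψ_{u,v}(x, y) = ψ_{v,u}(y, x)`; its values at non-adjacent pairs are never used. -/
structure PairwiseMRF {V : Type*} (G : SimpleGraph V) where
  vertexFactor : V → Fin 2 → ℝ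
  edgeFactor : V → V → Fin 2 → Fin 2 → ℝ
  vertexFactor_nonneg : ∀ v x, 0 ≤ vertexFactor v x
  edgeFactor_nonneg : ∀ u v, G.Adj u v → ∀ x y, 0 ≤ edgeFactor u v x y
  edgeFactor_symm : ∀ u v x y, edgeFactor u v x y = edgeFactor v u y x

noncomputable section

namespace PairwiseMRF

variable {V : Type*} [Fintype V] [DecidableEq V] {G : SimpleGraph V} [DecidableRel G.Adj]

/-- `ψ_u(x) ∏_{w ∈ N(u) \ v} m_{w → u}(x)`. The message `m_{u → v}(x)` is written `msg u v x`. -/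
def cavity (M : PairwiseMRF G) (msg : V → V → Fin 2 → ℝ) (u v : V) (x : Fin 2) : ℝ :=
  M.vertexFactor u x * ∏ w ∈ (G.neighborFinset u).erase v, msg w u x

/-- Nonnegative messages that are a fixed point of belief propagation:
`m_{u → v}(x_v) ∝ ∑_{x_u} ψ_{u,v}(x_u, x_v) ψ_u(x_u) ∏_{w ∈ N(u) \ v} m_{w → u}(x_u)`. -/
def IsBPFixedPoint (M : PairwiseMRF G) (msg : V → V → Fin 2 → ℝ) : Prop :=
  ∀ u v, G.Adj u v →
    (∀ x, 0 ≤ msg u v x) ∧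
    ∃ c : ℝ, 0 < c ∧ ∀ x, msg u v x = c * ∑ y, M.edgeFactor u v y x * M.cavity msg u v y

/-- `τ_v(x) ∝ ψ_v(x) ∏_{u ∈ N(v)} m_{u → v}(x)`, normalized. -/
def vertexBelief (M : PairwiseMRF G) (msg : V → V → Fin 2 → ℝ) (v : V) (x : Fin 2) : ℝ :=
  (M.vertexFactor v x * ∏ u ∈ G.neighborFinset v, msg u v x) /
    ∑ y, M.vertexFactor v y * ∏ u ∈ G.neighborFinset v, msg u v y

/-- `τ_{u,v}(x, y) ∝ ψ_u(x) ψ_v(y) ψ_{u,v}(x, y) ∏_{w ∈ N(u) \ v} m_{w → u}(x)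
∏_{w ∈ N(v) \ u} m_{w → v}(y)`, normalized. -/
def pairBelief (M : PairwiseMRF G) (msg : V → V → Fin 2 → ℝ) (u v : V) (x y : Fin 2) : ℝ :=
  (M.edgeFactor u v x y * M.cavity msg u v x * M.cavity msg v u y) /
    ∑ x', ∑ y', M.edgeFactor u v x' y' * M.cavity msg u v x' * M.cavity msg v u y'

theorem pairBelief_symm (M : PairwiseMRF G) (msg : V → V → Fin 2 → ℝ) (u v : V) (x y : Fin 2) :
    M.pairBelief msg u v x y = M.pairBelief msg v u y x := by
  have h : ∀ a b, M.edgeFactor u v a b * M.cavity msg u v a * M.cavity msg v u b =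
      M.edgeFactor v u b a * M.cavity msg v u b * M.cavity msg u v a := by
    intro a b
    rw [M.edgeFactor_symm u v a b]
    ring
  unfold pairBelief
  rw [h x y, Finset.sum_comm]
  simp only [h]

/-- The edge weight
`w(e) = |(τ_{u,v}(1,1) - τ_u(1) τ_v(1)) / √(τ_u(1) τ_v(1) (1 - τ_u(1)) (1 - τ_v(1)))|`. -/
def edgeWeight (M : PairwiseMRF G) (msg : V → V → Fin 2 → ℝ) : Sym2 V → ℝ :=
  Sym2.lift ⟨fun u v =>
    |(M.pairBelief msg u v 1 1 - M.vertexBelief msg u 1 * M.vertexBelief msg v 1) /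
      Real.sqrt (M.vertexBelief msg u 1 * M.vertexBelief msg v 1 *
        (1 - M.vertexBelief msg u 1) * (1 - M.vertexBelief msg v 1))|, by
    intro u v
    beta_reduce
    rw [M.pairBelief_symm msg u v, mul_comm (M.vertexBelief msg u 1) (M.vertexBelief msg v 1),
      mul_right_comm _ (1 - M.vertexBelief msg u 1)]⟩

/-- `τ_{u,v}(1,1) / (τ_u(1) τ_v(1)) - 1`, as a function of the unordered pair. -/
def edgeLoopFactor (M : PairwiseMRF G) (msg : V → V → Fin 2 → ℝ) : Sym2 V → ℝ :=
  Sym2.lift ⟨fun u v =>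
    M.pairBelief msg u v 1 1 / (M.vertexBelief msg u 1 * M.vertexBelief msg v 1) - 1, by
    intro u v
    beta_reduce
    rw [M.pairBelief_symm msg u v, mul_comm (M.vertexBelief msg u 1)]⟩

end PairwiseMRF

section Subgraphs

variable {V : Type*} [Fintype V] [DecidableEq V]

/-- The degree of `v` in the subgraph with edge set `F`. -/
def subDegree (F : Finset (Sym2 V)) (v : V) : ℕ := (F.filter (fun e => v ∈ e)).card

/-- The odd-degree vertices of the subgraph with edge set `F`. -/
def oddVertices (F : Finset (Sym2 V)) : Finset V :=
  Finset.univ.filter (fun v => Odd (subDegree F v))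

/-- The 2-regular loops of `G` (the empty subgraph included), as edge sets: every vertex covered by
`F` has degree two in `F`. -/
def twoRegularLoops (G : SimpleGraph V) [DecidableRel G.Adj] : Finset (Finset (Sym2 V)) :=
  G.edgeFinset.powerset.filter (fun F => ∀ v, subDegree F v ≠ 0 → subDegree F v = 2)

/-- The subgraphs of `G`, as edge sets, with exactly two odd-degree vertices. -/
def twoOddSubgraphs (G : SimpleGraph V) [DecidableRel G.Adj] : Finset (Finset (Sym2 V)) :=
  G.edgeFinset.powerset.filter (fun F => (oddVertices F).card = 2)

end Subgraphs

/-- The random bit that is `true` with probability `p`. -/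
def biasedCoin (p : ℝ) (h0 : 0 ≤ p) (h1 : p ≤ 1) : PMF Bool :=
  PMF.ofFintype (fun b => if b then ENNReal.ofReal p else ENNReal.ofReal (1 - p)) (by
    simp [← ENNReal.ofReal_add h0 (sub_nonneg.2 h1)])

/-- Pick a uniformly random element of `s` and continue with `f`; if `s` is empty, do `stay`. -/
def pickThen {α β : Type*} (s : Finset α) (stay : PMF β) (f : α → PMF β) : PMF β :=
  if h : s.Nonempty then (PMF.uniformOfFinset s h).bind f else stay

namespace PairwiseMRF

variable {V : Type*} [Fintype V] [DecidableEq V] {G : SimpleGraph V} [DecidableRel G.Adj]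

/-- The loop-series weight `w(F)` of a subgraph, given by its edge set. -/
def loopWeight (M : PairwiseMRF G) (msg : V → V → Fin 2 → ℝ) (F : Finset (Sym2 V)) : ℝ :=
  (∏ e ∈ F, M.edgeLoopFactor msg e) *
    ∏ v ∈ Finset.univ.filter (fun v => subDegree F v ≠ 0),
      (M.vertexBelief msg v 1 + (-1) ^ subDegree F v *
        (M.vertexBelief msg v 1 / (1 - M.vertexBelief msg v 1)) ^ (subDegree F v - 1) *
          M.vertexBelief msg v 1)

/-- The target distribution `π(F) = |w(F)| / ∑_{F' 2-regular loop} |w(F')|` on 2-regular loops. -/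
def loopDistribution (M : PairwiseMRF G) (msg : V → V → Fin 2 → ℝ) (F : Finset (Sym2 V)) : ℝ :=
  |M.loopWeight msg F| / ∑ F' ∈ twoRegularLoops G, |M.loopWeight msg F'|

/-- The weight `|w(F)|` of a state of the worm chain: the loop-series weight for 2-regular loops,
the product of the edge weights for the other states. -/
def stateWeight (M : PairwiseMRF G) (msg : V → V → Fin 2 → ℝ) (F : Finset (Sym2 V)) : ℝ :=
  if F ∈ twoRegularLoops G then |M.loopWeight msg F| else ∏ e ∈ F, M.edgeWeight msg e

theorem stateWeight_nonneg (M : PairwiseMRF G) (msg : V → V → Fin 2 → ℝ) (F : Finset (Sym2 V)) :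
    0 ≤ M.stateWeight msg F := by
  unfold stateWeight
  split_ifs
  · exact abs_nonneg _
  · refine Finset.prod_nonneg fun e _ => ?_
    induction e with
    | h u v => exact abs_nonneg _

/-- The coefficient of the weight ratio in the acceptance probability of the move
`F → F ⊕ {u, v}`, where `v` is the vertex picked first and `u` its neighbour. -/
def acceptCoeff (G : SimpleGraph V) [DecidableRel G.Adj] (F : Finset (Sym2 V)) (v u : V) : ℝ :=
  if F ∈ twoRegularLoops G then 1 / (Fintype.card V : ℝ)
  else if F ∆ {s(u, v)} ∈ twoRegularLoops G then (Fintype.card V : ℝ) / 4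
  else if F ∆ {s(u, v)} ∈ twoOddSubgraphs G then (G.degree v : ℝ) / (2 * (G.degree u : ℝ))
  else 0

theorem acceptCoeff_nonneg (F : Finset (Sym2 V)) (v u : V) : 0 ≤ acceptCoeff G F v u := by
  unfold acceptCoeff
  split_ifs <;> positivity

/-- The acceptance probability of the move `F → F ⊕ {u, v}`. -/
def acceptProb (M : PairwiseMRF G) (msg : V → V → Fin 2 → ℝ) (F : Finset (Sym2 V)) (v u : V) : ℝ :=
  min (acceptCoeff G F v u * (M.stateWeight msg (F ∆ {s(u, v)}) / M.stateWeight msg F)) (1 / 2)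

theorem acceptProb_nonneg (M : PairwiseMRF G) (msg : V → V → Fin 2 → ℝ) (F : Finset (Sym2 V))
    (v u : V) : 0 ≤ M.acceptProb msg F v u :=
  le_min (mul_nonneg (acceptCoeff_nonneg F v u)
    (div_nonneg (M.stateWeight_nonneg msg _) (M.stateWeight_nonneg msg _))) (by norm_num)

theorem acceptProb_le_one (M : PairwiseMRF G) (msg : V → V → Fin 2 → ℝ) (F : Finset (Sym2 V))
    (v u : V) : M.acceptProb msg F v u ≤ 1 :=
  (min_le_right _ _).trans (by norm_num)

/-- One step of the worm chain: pick a uniformly random vertex `v` (a uniformly random odd-degree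
vertex of `F` if `F` is not a 2-regular loop), a uniformly random neighbour `u` of `v` in `G`, and
move to `F ⊕ {u, v}` with the acceptance probability. Only in the one-vertex graph there is no
neighbour to pick; then the state does not change. -/
def wormStep (M : PairwiseMRF G) (msg : V → V → Fin 2 → ℝ) (F : Finset (Sym2 V)) :
    PMF (Finset (Sym2 V)) :=
  pickThen (if F ∈ twoRegularLoops G then Finset.univ else oddVertices F) (PMF.pure F) fun v =>
    pickThen (G.neighborFinset v) (PMF.pure F) fun u =>
      (biasedCoin (M.acceptProb msg F v u) (M.acceptProb_nonneg msg F v u)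
        (M.acceptProb_le_one msg F v u)).bind fun accepted =>
          PMF.pure (if accepted then F ∆ {s(u, v)} else F)

/-- The state after `T` iterations of the worm chain started from the empty subgraph. -/
def wormRun (M : PairwiseMRF G) (msg : V → V → Fin 2 → ℝ) : ℕ → PMF (Finset (Sym2 V))
  | 0 => PMF.pure ∅
  | T + 1 => (M.wormRun msg T).bind (M.wormStep msg)

/-- The output of the sampler with `N` trials of `T` worm iterations each: the final state of the
first trial that ends in a 2-regular loop, and the empty subgraph if all trials fail. -/
def loopSampler (M : PairwiseMRF G) (msg : V → V → Fin 2 → ℝ) (T : ℕ) :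
    ℕ → PMF (Finset (Sym2 V))
  | 0 => PMF.pure ∅
  | N + 1 => (M.wormRun msg T).bind fun F =>
      if F ∈ twoRegularLoops G then PMF.pure F else M.loopSampler msg T N

end PairwiseMRF

end

/-! Since `G.maxDegree ≤ 3`, a 2-regular loop is the same as an even subgraph. At a belief
propagation fixed point the pair beliefs have the vertex beliefs as marginals, so each edge weight
is the absolute correlation of two binary variables and lies in `[0, 1]`. On loops the loop-series
weight is, in absolute value, the product of the edge weights.

Let `Z_S` be the weighted count of subgraphs with odd-vertex set `S` (`parityPoly`). Expanding an
Ising partition function with edge factors `1 + w σ_u σ_v ≥ 0` gives `Z_S ≤ Z_∅`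
(`parityPoly_le_empty`). The worm chain is lazy and reversible for the mass `n² w(F)` on loops and
`4 w(F)` on subgraphs with two odd vertices (`wormMass_mul_wormKernel`). The total mass is therefore
at most `(n² + 4 n(n-1)/2) Z_∅ = (3n² - 2n) Z_∅`, of which the loops hold `n² Z_∅`, a fraction above
`1/3`.

Mixing follows from canonical paths. A worm state `I` is joined to an even state `F` by toggling the
edges of `I ∆ F` one at a time through worm states. An injective encoding of the paths through a
given transition (`canonical_path_estimate`) gives the Poincaré constant `6 Δ m n²`
(`worm_poincare`). Laziness turns it into geometric decay of the chi-square distance, which starts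
below `3 · 2^m` (`worm_mixing`). After `T` steps the total `ℓ¹` error is at most `δ / (3n)`.

Conditioned on being a loop, the stationary law is the target. A trial succeeds with probability at
least `5 / (6n)`, so rejection (`rejection_sampling_error`) multiplies the error by at most `6n /
5`, and `N` trials all fail with probability at most `δ / 3`. -/

noncomputable section

/-! ### Parities of degrees and worm states. -/

section Parity

variable {V : Type*} [DecidableEq V]

theorem card_symmDiff_add {α : Type*} [DecidableEq α] (s t : Finset α) :
    (s ∆ t).card + 2 * (s ∩ t).card = s.card + t.card := by
  have h1 := Finset.card_sdiff_add_card_inter s t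
  have h2 := Finset.card_sdiff_add_card_inter t s
  have h3 : (s ∆ t).card = (s \ t).card + (t \ s).card :=
    Finset.card_union_of_disjoint disjoint_sdiff_sdiff
  rw [Finset.inter_comm t s] at h2
  omega

theorem odd_subDegree_symmDiff (F H : Finset (Sym2 V)) (v : V) :
    Odd (subDegree (F ∆ H) v) ↔ ¬(Odd (subDegree F v) ↔ Odd (subDegree H v)) := by
  have h : (F ∆ H).filter (fun e => v ∈ e) =
      (F.filter (fun e => v ∈ e)) ∆ (H.filter (fun e => v ∈ e)) := by
    ext e
    simp only [Finset.mem_filter, Finset.mem_symmDiff]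
    tauto
  have := card_symmDiff_add (F.filter (fun e => v ∈ e)) (H.filter (fun e => v ∈ e))
  unfold subDegree
  rw [h]
  simp only [Nat.odd_iff]
  omega

theorem symmDiff_pair_of_mem {a b u : V} (hab : a ≠ b) {y : V} (hy : y ≠ u)
    (hu : u ∈ ({a, b} : Finset V)) :
    (({a, b} : Finset V) ∆ {u, y}).card = 0 ∨ (({a, b} : Finset V) ∆ {u, y}).card = 2 := by
  have h := card_symmDiff_add ({a, b} : Finset V) {u, y}
  have hm : u ∈ ({a, b} : Finset V) ∩ {u, y} := by simp [Finset.mem_inter, hu]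
  have h1 : 1 ≤ (({a, b} : Finset V) ∩ {u, y}).card := Finset.card_pos.2 ⟨u, hm⟩
  rw [Finset.card_pair hab, Finset.card_pair hy.symm] at h
  omega

variable [Fintype V]

theorem mem_oddVertices {F : Finset (Sym2 V)} {v : V} :
    v ∈ oddVertices F ↔ Odd (subDegree F v) := by
  simp [oddVertices]

theorem oddVertices_symmDiff (F H : Finset (Sym2 V)) :
    oddVertices (F ∆ H) = oddVertices F ∆ oddVertices H := by
  ext v
  rw [mem_oddVertices, odd_subDegree_symmDiff, Finset.mem_symmDiff, mem_oddVertices,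
    mem_oddVertices]
  tauto

theorem oddVertices_empty : oddVertices (∅ : Finset (Sym2 V)) = ∅ := by
  ext v
  simp [oddVertices, subDegree]

theorem oddVertices_singleton (u v : V) :
    oddVertices {s(u, v)} = {u, v} := by
  ext x
  rw [mem_oddVertices, subDegree, Finset.filter_singleton]
  by_cases hx : x ∈ s(u, v)
  · rw [if_pos hx]
    simpa using hx
  · rw [if_neg hx]
    simpa using hx

/-- The states of the worm chain: no or exactly two vertices of odd degree. -/
def IsWormState (F : Finset (Sym2 V)) : Prop :=
  (oddVertices F).card = 0 ∨ (oddVertices F).card = 2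

instance (F : Finset (Sym2 V)) : Decidable (IsWormState F) := by
  unfold IsWormState; infer_instance

theorem isWormState_congr {F H : Finset (Sym2 V)} (h : oddVertices F = oddVertices H) :
    IsWormState F ↔ IsWormState H := by
  unfold IsWormState
  rw [h]

/-- Toggling an edge at an odd vertex `u` moves the defect from `u` to `y`, or annihilates both
defects if `y` is the other one. -/
theorem IsWormState.symmDiff_of_mem {F : Finset (Sym2 V)} (hF : (oddVertices F).card = 2) {u y : V}
    (hy : y ≠ u) (hu : u ∈ oddVertices F) : IsWormState (F ∆ {s(u, y)}) := by
  obtain ⟨a, b, hab, h⟩ := Finset.card_eq_two.1 hF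
  unfold IsWormState
  rw [oddVertices_symmDiff, oddVertices_singleton, h]
  exact symmDiff_pair_of_mem hab hy (h ▸ hu)

theorem card_oddVertices_symmDiff_of_even {F : Finset (Sym2 V)} (hF : oddVertices F = ∅) {u y : V}
    (hy : u ≠ y) : (oddVertices (F ∆ {s(u, y)})).card = 2 := by
  rw [oddVertices_symmDiff, oddVertices_singleton, hF, ← Finset.bot_eq_empty, bot_symmDiff,
    Finset.card_pair hy]

theorem exists_edge_isWormState {D : Finset (Sym2 V)} (hloop : ∀ e ∈ D, ¬e.IsDiag)
    (hD : IsWormState D) (hne : D.Nonempty) : ∃ e ∈ D, IsWormState (D ∆ {e}) := by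
  rcases hD with h | h
  · obtain ⟨e, he⟩ := hne
    refine ⟨e, he, ?_⟩
    induction e with
    | h u v =>
      have huv : u ≠ v := fun hh => hloop _ he (by simpa using hh)
      exact Or.inr (card_oddVertices_symmDiff_of_even (Finset.card_eq_zero.1 h) huv)
  · obtain ⟨u, hu⟩ : (oddVertices D).Nonempty := Finset.card_pos.1 (by omega)
    have h1 : 0 < subDegree D u := (mem_oddVertices.1 hu).pos
    obtain ⟨e, he⟩ := Finset.card_pos.1 h1
    rw [Finset.mem_filter] at he
    obtain ⟨y, rfl⟩ := he.2
    refine ⟨_, he.1, IsWormState.symmDiff_of_mem h ?_ hu⟩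
    intro hh
    exact hloop _ he.1 (by simpa using hh.symm)

/-- The edges of a worm state `D` can be removed one by one, always staying in a worm state;
`pre e` is the set of edges removed before `e`. -/
theorem exists_removal_order : ∀ (k : ℕ) (D : Finset (Sym2 V)), D.card = k →
    (∀ e ∈ D, ¬e.IsDiag) → IsWormState D →
    ∃ pre : Sym2 V → Finset (Sym2 V),
      (∀ e ∈ D, pre e ⊆ D ∧ e ∉ pre e ∧ IsWormState (D ∆ pre e) ∧
        IsWormState (D ∆ pre e ∆ {e})) ∧
      ∀ (f : Finset (Sym2 V) → ℝ) (I : Finset (Sym2 V)),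
        f I - f (I ∆ D) = ∑ e ∈ D, (f (I ∆ pre e) - f (I ∆ pre e ∆ {e})) := by
  intro k
  induction k with
  | zero =>
    intro D hk _ _
    rw [Finset.card_eq_zero] at hk
    subst hk
    refine ⟨fun _ => ∅, by simp, fun f I => ?_⟩
    rw [← Finset.bot_eq_empty, symmDiff_bot]
    simp
  | succ k ih =>
    intro D hk hloop hD
    obtain ⟨a, ha, hDa⟩ := exists_edge_isWormState hloop hD (Finset.card_pos.1 (by omega))
    have hE : D ∆ {a} = D.erase a := by
      ext e
      simp only [Finset.mem_symmDiff, Finset.mem_singleton, Finset.mem_erase]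
      by_cases h : e = a
      · subst h; simp [ha]
      · simp [h]
    rw [hE] at hDa
    obtain ⟨pre, h1, h2⟩ := ih (D.erase a) (by rw [Finset.card_erase_of_mem ha]; omega)
      (fun e he => hloop e (Finset.mem_of_mem_erase he)) hDa
    have hins : ∀ e ∈ D.erase a, insert a (pre e) = {a} ∆ pre e := by
      intro e he
      have : a ∉ pre e := fun hh => by simpa using (h1 e he).1 hh
      ext x
      simp only [Finset.mem_insert, Finset.mem_symmDiff, Finset.mem_singleton]
      by_cases h : x = a
      · subst h; simp [this]
      · simp [h]
    -- The edge `a` goes first, so its prefix is empty and every other prefix gains `a`. The order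
    -- depends on `D` only, not on the start `I`; the path encoding needs this.
    refine ⟨fun e => if e = a then ∅ else insert a (pre e), ?_, ?_⟩
    · intro e he
      by_cases h : e = a
      · subst h
        simp only [if_true]
        refine ⟨by simp, by simp, ?_, ?_⟩
        · rw [← Finset.bot_eq_empty, symmDiff_bot]; exact hD
        · rw [← Finset.bot_eq_empty, symmDiff_bot, hE]; exact hDa
      · have he' : e ∈ D.erase a := Finset.mem_erase.2 ⟨h, he⟩
        obtain ⟨g1, g2, g3, g4⟩ := h1 e he'
        simp only [if_neg h]
        refine ⟨?_, ?_, ?_, ?_⟩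
        · exact Finset.insert_subset ha (g1.trans (Finset.erase_subset _ _))
        · simp [h, g2]
        · rw [hins e he', ← symmDiff_assoc, hE]; exact g3
        · rw [hins e he', ← symmDiff_assoc, hE]; exact g4
    · intro f I
      rw [← Finset.add_sum_erase D _ ha]
      have h3 := h2 f (I ∆ {a})
      have h4 : I ∆ {a} ∆ D.erase a = I ∆ D := by
        rw [← hE, symmDiff_assoc, symmDiff_comm D, symmDiff_symmDiff_cancel_left]
      rw [h4] at h3
      have h5 : ∑ e ∈ D.erase a, (f (I ∆ (if e = a then ∅ else insert a (pre e))) -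
          f (I ∆ (if e = a then ∅ else insert a (pre e)) ∆ {e})) =
          ∑ e ∈ D.erase a, (f (I ∆ {a} ∆ pre e) - f (I ∆ {a} ∆ pre e ∆ {e})) := by
        refine Finset.sum_congr rfl fun e he => ?_
        rw [if_neg (Finset.ne_of_mem_erase he), hins e he, symmDiff_assoc I {a}]
      simp only [h5, ← h3, if_true]
      rw [← Finset.bot_eq_empty, symmDiff_bot]
      ring

end Parity

/-! ### High-temperature expansion of the Ising model. -/

section SpinExpansion

variable {V : Type*} [Fintype V] [DecidableEq V]

/-- Double counting of incidences. It serves both the spin expansion and the splitting of the loop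
weight over edges. -/
theorem prod_edges_prod_endpoints {R : Type*} [CommMonoid R] (F : Finset (Sym2 V)) (h : V → R) :
    ∏ e ∈ F, ∏ v ∈ Finset.univ.filter (fun v => v ∈ e), h v = ∏ v, h v ^ subDegree F v := by
  simp_rw [Finset.prod_filter]
  rw [Finset.prod_comm]
  refine Finset.prod_congr rfl fun v _ => ?_
  rw [← Finset.prod_filter, Finset.prod_const, subDegree]

/-- The generating function of the subgraphs of `E` whose set of odd vertices is `S`. -/
def parityPoly (E : Finset (Sym2 V)) (w : Sym2 V → ℝ) (S : Finset V) : ℝ :=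
  ∑ F ∈ E.powerset.filter (fun F => oddVertices F = S), ∏ e ∈ F, w e

/-- The sum factorizes over the vertices, and an odd exponent contributes the factor `1 + (-1) = 0`.
-/
theorem sum_spins_prod_pow (k : V → ℕ) :
    ∑ σ : V → Bool, ∏ v, (if σ v then (-1 : ℝ) else 1) ^ k v =
      if ∀ v, Even (k v) then 2 ^ Fintype.card V else 0 := by
  rw [← Fintype.prod_sum (fun v (b : Bool) => (if b then (-1 : ℝ) else 1) ^ k v)]
  split_ifs with h
  · rw [← Finset.card_univ, ← Finset.prod_const]
    refine Finset.prod_congr rfl fun v _ => ?_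
    simp [(h v).neg_one_pow, one_add_one_eq_two]
  · push Not at h
    obtain ⟨v, hv⟩ := h
    refine Finset.prod_eq_zero (Finset.mem_univ v) ?_
    rw [Nat.not_even_iff_odd] at hv
    simp [hv.neg_one_pow]

/-- Multiplying out the edge factors gives one term per subgraph `F`, with spin `σ v` raised to the
degree of `v` in `F`. Summation over the spins keeps exactly those `F` whose odd vertices form `S`.
-/
theorem two_pow_mul_parityPoly (E : Finset (Sym2 V)) (w : Sym2 V → ℝ) (S : Finset V) :
    2 ^ Fintype.card V * parityPoly E w S =
      ∑ σ : V → Bool, (∏ e ∈ E, (1 + w e *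
        ∏ v ∈ Finset.univ.filter (fun v => v ∈ e), (if σ v then (-1 : ℝ) else 1))) *
          ∏ v, (if σ v then (-1 : ℝ) else 1) ^ (if v ∈ S then 1 else 0) := by
  simp_rw [Finset.prod_one_add, Finset.prod_mul_distrib, prod_edges_prod_endpoints,
    Finset.sum_mul, mul_assoc, ← Finset.prod_mul_distrib, ← pow_add]
  rw [Finset.sum_comm]
  simp_rw [← Finset.mul_sum, sum_spins_prod_pow]
  rw [parityPoly, Finset.sum_filter, Finset.mul_sum]
  refine Finset.sum_congr rfl fun F _ => ?_
  have : (oddVertices F = S) ↔ ∀ v, Even (subDegree F v + if v ∈ S then 1 else 0) := by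
    rw [Finset.ext_iff]
    refine forall_congr' fun v => ?_
    rw [mem_oddVertices]
    by_cases hv : v ∈ S
    · simp [hv, Nat.even_add_one]
    · simp [hv]
  simp only [this]
  split_ifs <;> ring

/-- Spin by spin: the Boltzmann weights are nonnegative because `0 ≤ w ≤ 1`, and a product of spins
is at most `1`. -/
theorem parityPoly_le_empty (E : Finset (Sym2 V)) {w : Sym2 V → ℝ} (h0 : ∀ e ∈ E, 0 ≤ w e)
    (h1 : ∀ e ∈ E, w e ≤ 1) (S : Finset V) : parityPoly E w S ≤ parityPoly E w ∅ := by
  have h2 : (0 : ℝ) < 2 ^ Fintype.card V := by positivity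
  refine le_of_mul_le_mul_left ?_ h2
  rw [two_pow_mul_parityPoly, two_pow_mul_parityPoly]
  refine Finset.sum_le_sum fun σ _ => mul_le_mul_of_nonneg_left ?_ ?_
  · simp only [Finset.notMem_empty, if_false, pow_zero, Finset.prod_const_one]
    refine le_trans (le_abs_self _) ?_
    rw [Finset.abs_prod]
    refine le_of_eq (Finset.prod_eq_one fun v _ => ?_)
    rw [abs_pow]
    split_ifs <;> simp
  · refine Finset.prod_nonneg fun e he => ?_
    have h3 : |∏ v ∈ Finset.univ.filter (fun v => v ∈ e), (if σ v then (-1 : ℝ) else 1)| = 1 := by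
      rw [Finset.abs_prod]
      refine Finset.prod_eq_one fun v _ => ?_
      split_ifs <;> simp
    rcases abs_eq (zero_le_one) |>.1 h3 with h | h <;> rw [h]
    · linarith [h0 e he]
    · linarith [h1 e he]

theorem parityPoly_nonneg (E : Finset (Sym2 V)) {w : Sym2 V → ℝ} (h0 : ∀ e ∈ E, 0 ≤ w e)
    (S : Finset V) : 0 ≤ parityPoly E w S :=
  Finset.sum_nonneg fun _ hF => Finset.prod_nonneg fun e he =>
    h0 e (Finset.mem_powerset.1 (Finset.mem_filter.1 hF).1 he)

theorem one_le_parityPoly_empty (E : Finset (Sym2 V)) {w : Sym2 V → ℝ} (h0 : ∀ e ∈ E, 0 ≤ w e) :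
    1 ≤ parityPoly E w ∅ := by
  have h := Finset.single_le_sum (f := fun F => ∏ e ∈ F, w e)
    (s := E.powerset.filter (fun F => oddVertices F = ∅)) (a := ∅)
    (fun _ hF => Finset.prod_nonneg fun e he =>
      h0 e (Finset.mem_powerset.1 (Finset.mem_filter.1 hF).1 he))
    (by simp [oddVertices_empty])
  simpa [parityPoly] using h

theorem parityPoly_le_two_pow (E : Finset (Sym2 V)) {w : Sym2 V → ℝ} (h0 : ∀ e ∈ E, 0 ≤ w e)
    (h1 : ∀ e ∈ E, w e ≤ 1) (S : Finset V) : parityPoly E w S ≤ 2 ^ E.card := by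
  have h : parityPoly E w S ≤ ∑ F ∈ E.powerset.filter (fun F => oddVertices F = S), (1 : ℝ) := by
    refine Finset.sum_le_sum fun F hF => ?_
    have hs := Finset.mem_powerset.1 (Finset.mem_filter.1 hF).1
    exact Finset.prod_le_one (fun e he => h0 e (hs he)) (fun e he => h1 e (hs he))
  refine h.trans ?_
  rw [Finset.sum_const, nsmul_eq_mul, mul_one]
  have := Finset.card_filter_le E.powerset (fun F => oddVertices F = S)
  rw [Finset.card_powerset] at this
  exact_mod_cast this

/-- The subgraphs with two odd vertices weigh at most `n (n - 1) / 2` times the even ones. -/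
theorem sum_two_odd_parity_le (E : Finset (Sym2 V)) {w : Sym2 V → ℝ} (h0 : ∀ e ∈ E, 0 ≤ w e)
    (h1 : ∀ e ∈ E, w e ≤ 1) (R : Finset V) :
    ∑ S ∈ Finset.univ.filter (fun S : Finset V => S.card = 2), parityPoly E w (S ∆ R) ≤
      (Fintype.card V : ℝ) * ((Fintype.card V : ℝ) - 1) / 2 * parityPoly E w ∅ := by
  refine (Finset.sum_le_sum fun S _ => parityPoly_le_empty E h0 h1 _).trans ?_
  rw [Finset.sum_const, nsmul_eq_mul]
  have : (Finset.univ.filter (fun S : Finset V => S.card = 2)).card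
      = (Fintype.card V).choose 2 := by
    rw [Finset.univ_filter_card_eq, Finset.card_powersetCard, Finset.card_univ]
  rw [this, Nat.cast_choose_two]

end SpinExpansion

end

/-! ### Convergence of lazy reversible chains from a Poincaré inequality. -/

section ReversibleChains

variable {α : Type*} [Fintype α]

/-- The Dirichlet form of a reversible stochastic kernel. -/
theorem dirichlet_form_eq {ρ : α → ℝ} {P : α → α → ℝ} (hP1 : ∀ x, ∑ y, P x y = 1)
    (hrev : ∀ x y, ρ x * P x y = ρ y * P y x) (f : α → ℝ) :
    (1 / 2) * ∑ x, ∑ y, ρ x * P x y * (f x - f y) ^ 2 =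
      ∑ x, ρ x * f x ^ 2 - ∑ x, ρ x * f x * ∑ y, P x y * f y := by
  have e1 : ∑ x, ∑ y, ρ x * P x y * f x ^ 2 = ∑ x, ρ x * f x ^ 2 := by
    refine Finset.sum_congr rfl fun x _ => ?_
    rw [← Finset.sum_mul, ← Finset.mul_sum, hP1, mul_one]
  have e2 : ∑ x, ∑ y, ρ x * P x y * f y ^ 2 = ∑ x, ρ x * f x ^ 2 := by
    rw [Finset.sum_comm, ← e1]
    refine Finset.sum_congr rfl fun x _ => Finset.sum_congr rfl fun y _ => ?_
    rw [hrev]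
  have e3 : ∑ x, ∑ y, ρ x * P x y * (f x * f y) = ∑ x, ρ x * f x * ∑ y, P x y * f y := by
    refine Finset.sum_congr rfl fun x _ => ?_
    rw [Finset.mul_sum]
    exact Finset.sum_congr rfl fun y _ => by ring
  have : ∑ x, ∑ y, ρ x * P x y * (f x - f y) ^ 2 =
      ∑ x, ∑ y, ρ x * P x y * f x ^ 2 + ∑ x, ∑ y, ρ x * P x y * f y ^ 2
        - 2 * ∑ x, ∑ y, ρ x * P x y * (f x * f y) := by
    simp_rw [Finset.mul_sum, ← Finset.sum_add_distrib, ← Finset.sum_sub_distrib]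
    exact Finset.sum_congr rfl fun x _ => Finset.sum_congr rfl fun y _ => by ring
  rw [this, e1, e2, e3]
  ring

/-- A reversible kernel is an `ℓ²(ρ)` contraction: Cauchy–Schwarz in each row, then stationarity of
`ρ`. -/
theorem sum_sq_kernel_le {ρ : α → ℝ} {Q : α → α → ℝ} (hρ : ∀ x, 0 ≤ ρ x) (hQ : ∀ x y, 0 ≤ Q x y)
    (hQ1 : ∀ x, ∑ y, Q x y = 1) (hrev : ∀ x y, ρ x * Q x y = ρ y * Q y x) (f : α → ℝ) :
    ∑ x, ρ x * (∑ y, Q x y * f y) ^ 2 ≤ ∑ x, ρ x * f x ^ 2 := by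
  have h1 : ∀ x, (∑ y, Q x y * f y) ^ 2 ≤ ∑ y, Q x y * f y ^ 2 := by
    intro x
    have h := Finset.sum_mul_sq_le_sq_mul_sq Finset.univ (fun y => Real.sqrt (Q x y))
      (fun y => Real.sqrt (Q x y) * f y)
    simpa only [mul_pow, ← mul_assoc, Real.mul_self_sqrt (hQ x _), Real.sq_sqrt (hQ x _), hQ1,
      one_mul] using h
  have h2 : ∑ x, ∑ y, ρ x * Q x y * f y ^ 2 = ∑ x, ρ x * f x ^ 2 := by
    rw [Finset.sum_comm]
    refine Finset.sum_congr rfl fun y _ => ?_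
    simp_rw [fun x => hrev x y]
    rw [← Finset.sum_mul, ← Finset.mul_sum, hQ1, mul_one]
  rw [← h2]
  refine Finset.sum_le_sum fun x _ => ?_
  calc _ ≤ ρ x * ∑ y, Q x y * f y ^ 2 := mul_le_mul_of_nonneg_left (h1 x) (hρ x)
    _ = _ := by
      rw [Finset.mul_sum]
      exact Finset.sum_congr rfl fun y _ => by ring

/-- One step of a lazy reversible chain contracts the variance. -/
theorem variance_contraction [DecidableEq α] {ρ : α → ℝ} {P : α → α → ℝ} (hρ : ∀ x, 0 ≤ ρ x)
    (hP : ∀ x y, 0 ≤ P x y) (hP1 : ∀ x, ∑ y, P x y = 1)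
    (hrev : ∀ x y, ρ x * P x y = ρ y * P y x) (hlazy : ∀ x, 1 / 2 ≤ P x x) (f : α → ℝ) :
    ∑ x, ρ x * (∑ y, P x y * f y) ^ 2 ≤
      ∑ x, ρ x * f x ^ 2 - (1 / 2) * ∑ x, ∑ y, ρ x * P x y * (f x - f y) ^ 2 := by
  rw [dirichlet_form_eq hP1 hrev]
  -- Laziness makes `Q = 2P - 1` a stochastic kernel, still reversible. Expanding `‖Qf‖² ≤ ‖f‖²`
  -- gives `‖Pf‖² ≤ ⟨f, Pf⟩`, which is the claim.
  set Q : α → α → ℝ := fun x y => 2 * P x y - if x = y then 1 else 0 with hQdef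
  have hQ : ∀ x y, 0 ≤ Q x y := by
    intro x y
    simp only [hQdef]
    split_ifs with h
    · subst h; linarith [hlazy x]
    · linarith [hP x y]
  have hQ1 : ∀ x, ∑ y, Q x y = 1 := by
    intro x
    simp only [hQdef, Finset.sum_sub_distrib, ← Finset.mul_sum, hP1]
    simp; norm_num
  have hQrev : ∀ x y, ρ x * Q x y = ρ y * Q y x := by
    intro x y
    simp only [hQdef]
    by_cases h : x = y
    · subst h; rfl
    · simp only [h, Ne.symm h, if_false]; linarith [hrev x y]
  have h := sum_sq_kernel_le hρ hQ hQ1 hQrev f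
  have hQf : ∀ x, ∑ y, Q x y * f y = 2 * (∑ y, P x y * f y) - f x := by
    intro x
    simp only [hQdef, sub_mul, Finset.sum_sub_distrib, mul_assoc, ← Finset.mul_sum]
    simp
  simp_rw [hQf] at h
  have h' : ∑ x, ρ x * (2 * (∑ y, P x y * f y) - f x) ^ 2 =
      4 * ∑ x, ρ x * (∑ y, P x y * f y) ^ 2 - 4 * ∑ x, ρ x * f x * ∑ y, P x y * f y +
        ∑ x, ρ x * f x ^ 2 := by
    simp_rw [Finset.mul_sum (s := Finset.univ) (a := (4 : ℝ)), ← Finset.sum_sub_distrib,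
      ← Finset.sum_add_distrib]
    exact Finset.sum_congr rfl fun x _ => by ring
  rw [h'] at h
  linarith

/-- Convergence of a lazy reversible chain with Poincaré constant `C`. -/
theorem sum_abs_sub_stationary_le [DecidableEq α] {ρ : α → ℝ} {P : α → α → ℝ}
    (hρ : ∀ x, 0 ≤ ρ x) (hρ1 : ∑ x, ρ x = 1) (hP : ∀ x y, 0 ≤ P x y) (hP1 : ∀ x, ∑ y, P x y = 1)
    (hrev : ∀ x y, ρ x * P x y = ρ y * P y x) (hlazy : ∀ x, 1 / 2 ≤ P x x)
    {C : ℝ} (hC : 1 ≤ C)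
    (hgap : ∀ f : α → ℝ, ∑ x, ρ x * f x = 0 →
      ∑ x, ρ x * f x ^ 2 ≤ C * ((1 / 2) * ∑ x, ∑ y, ρ x * P x y * (f x - f y) ^ 2))
    {a : α} (ha : 0 < ρ a) (μ : ℕ → α → ℝ) (hμ0 : ∀ x, μ 0 x = if x = a then 1 else 0)
    (hμ : ∀ t y, μ (t + 1) y = ∑ x, μ t x * P x y) (t : ℕ) :
    (∑ x, |μ t x - ρ x|) ^ 2 ≤ (1 - 1 / C) ^ t / ρ a := by
  have hC0 : 0 < C := by linarith
  have hc : 0 ≤ 1 - 1 / C := by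
    rw [sub_nonneg, div_le_one hC0]; exact hC
  -- Here `1 + f` is the density of `μ t` with respect to `ρ`. By reversibility one step of the
  -- chain sends `f` to `P f`, so its norm shrinks by the factor `1 - 1/C`.
  have key : ∀ t, ∃ f : α → ℝ, (∀ x, μ t x = ρ x * (1 + f x)) ∧ ∑ x, ρ x * f x = 0 ∧
      ∑ x, ρ x * f x ^ 2 ≤ (1 - 1 / C) ^ t / ρ a := by
    intro t
    induction t with
    | zero =>
      refine ⟨fun x => (if x = a then 1 / ρ a else 0) - 1, ?_, ?_, ?_⟩
      · intro x
        rw [hμ0]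
        by_cases h : x = a
        · subst h; simp [ha.ne']
        · simp [h]
      · simp only [mul_sub, Finset.sum_sub_distrib, mul_one, hρ1, mul_ite, mul_zero,
          Finset.sum_ite_eq', Finset.mem_univ, if_true]
        field_simp; ring
      · have : ∀ x, ρ x * ((if x = a then 1 / ρ a else 0) - 1) ^ 2 =
            (if x = a then 1 / ρ a - 2 else 0) + ρ x := by
          intro x
          split_ifs with h
          · subst h; field_simp; ring
          · ring
        simp only [this, Finset.sum_add_distrib, hρ1, Finset.sum_ite_eq', Finset.mem_univ, if_true]
        rw [pow_zero]
        linarith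
    | succ t ih =>
      obtain ⟨f, h1, h2, h3⟩ := ih
      refine ⟨fun x => ∑ y, P x y * f y, ?_, ?_, ?_⟩
      · intro y
        rw [hμ]
        simp only [h1]
        calc ∑ x, ρ x * (1 + f x) * P x y = ∑ x, ρ y * P y x * (1 + f x) := by
              refine Finset.sum_congr rfl fun x _ => ?_
              rw [← hrev]; ring
          _ = ρ y * (∑ x, P y x + ∑ x, P y x * f x) := by
              rw [← Finset.sum_add_distrib, Finset.mul_sum]
              exact Finset.sum_congr rfl fun x _ => by ring
          _ = _ := by rw [hP1]
      · simp_rw [Finset.mul_sum]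
        rw [Finset.sum_comm, ← h2]
        refine Finset.sum_congr rfl fun y _ => ?_
        simp_rw [← mul_assoc, fun x => hrev x y]
        rw [← Finset.sum_mul, ← Finset.mul_sum, hP1, mul_one]
      · have h4 := variance_contraction hρ hP hP1 hrev hlazy f
        have h5 := hgap f h2
        have h6 : (1 / C) * ∑ x, ρ x * f x ^ 2 ≤
            (1 / 2) * ∑ x, ∑ y, ρ x * P x y * (f x - f y) ^ 2 := by
          rw [one_div, inv_mul_le_iff₀ hC0]; exact h5
        have h7 := mul_le_mul_of_nonneg_left h3 hc
        rw [pow_succ]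
        calc _ ≤ (1 - 1 / C) * ∑ x, ρ x * f x ^ 2 := by linarith
          _ ≤ _ := h7
          _ = _ := by ring
  obtain ⟨f, h1, -, h3⟩ := key t
  have h4 : ∀ x, |μ t x - ρ x| = ρ x * |f x| := by
    intro x
    rw [h1, mul_add, mul_one, add_sub_cancel_left, abs_mul, abs_of_nonneg (hρ x)]
  simp_rw [h4]
  refine le_trans ?_ h3
  -- Cauchy–Schwarz bounds the `ℓ¹` distance by the chi-square distance.
  have h5 := Finset.sum_mul_sq_le_sq_mul_sq Finset.univ (fun x => Real.sqrt (ρ x))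
    (fun x => Real.sqrt (ρ x) * |f x|)
  simp only [mul_pow, ← mul_assoc, Real.mul_self_sqrt (hρ _), Real.sq_sqrt (hρ _), sq_abs, hρ1,
    one_mul] at h5
  exact h5

end ReversibleChains

/-! ### Beliefs, edge weights and loop weights. -/

noncomputable section

namespace PairwiseMRF

variable {V : Type*} [Fintype V] {G : SimpleGraph V} [DecidableRel G.Adj]

/-- Division by zero yields `0`, so a nonzero belief certifies a nonzero normalizer. -/
theorem sum_vertexBelief {M : PairwiseMRF G} {msg : V → V → Fin 2 → ℝ} {v : V}
    (h : M.vertexBelief msg v 1 ≠ 0) : ∑ x, M.vertexBelief msg v x = 1 := by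
  simp only [vertexBelief, ← Finset.sum_div] at h ⊢
  exact div_self fun h0 => h (by rw [h0, div_zero])

variable [DecidableEq V]

section Beliefs

variable {M : PairwiseMRF G} {msg : V → V → Fin 2 → ℝ}

theorem cavity_mul_msg (M : PairwiseMRF G) (msg : V → V → Fin 2 → ℝ) {u v : V} (h : G.Adj u v)
    (x : Fin 2) :
    M.vertexFactor u x * ∏ w ∈ G.neighborFinset u, msg w u x =
      M.cavity msg u v x * msg v u x := by
  rw [cavity, mul_assoc, Finset.prod_erase_mul]
  simpa using h

theorem cavity_nonneg (hmsg : M.IsBPFixedPoint msg) (u v : V) (x : Fin 2) :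
    0 ≤ M.cavity msg u v x := by
  refine mul_nonneg (M.vertexFactor_nonneg u x) (Finset.prod_nonneg fun w hw => ?_)
  have : G.Adj w u := by simpa [G.adj_comm] using (Finset.mem_of_mem_erase hw)
  exact (hmsg w u this).1 x

theorem pairBelief_nonneg (hmsg : M.IsBPFixedPoint msg) {u v : V} (h : G.Adj u v) (x y : Fin 2) :
    0 ≤ M.pairBelief msg u v x y := by
  have : ∀ x y, 0 ≤ M.edgeFactor u v x y * M.cavity msg u v x * M.cavity msg v u y := fun x y =>
    mul_nonneg (mul_nonneg (M.edgeFactor_nonneg u v h x y) (cavity_nonneg hmsg _ _ _))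
      (cavity_nonneg hmsg _ _ _)
  exact div_nonneg (this x y) (Finset.sum_nonneg fun x _ => Finset.sum_nonneg fun y _ => this x y)

/-- The pair beliefs of a fixed point are consistent with the vertex beliefs. -/
theorem sum_pairBelief (hmsg : M.IsBPFixedPoint msg) {u v : V} (h : G.Adj u v) (x : Fin 2) :
    ∑ y, M.pairBelief msg u v x y = M.vertexBelief msg u x := by
  obtain ⟨-, c, hc, hm⟩ := hmsg v u h.symm
  have key : ∀ x, M.vertexFactor u x * ∏ w ∈ G.neighborFinset u, msg w u x =
      c * ∑ y, M.edgeFactor u v x y * M.cavity msg u v x * M.cavity msg v u y := by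
    intro x
    rw [cavity_mul_msg M msg h, hm, Finset.mul_sum, Finset.mul_sum, Finset.mul_sum]
    refine Finset.sum_congr rfl fun y _ => ?_
    rw [M.edgeFactor_symm v u]
    ring
  simp only [vertexBelief, key, pairBelief, ← Finset.mul_sum, ← Finset.sum_div]
  rw [mul_div_mul_left _ _ hc.ne']

/-- The covariance of a `2 × 2` probability table is its determinant `ps - qr`. In absolute value it
is at most `ps + qr`, which is at most each of the two variances. -/
theorem covariance_sq_le {p q r s : ℝ} (hp : 0 ≤ p) (hq : 0 ≤ q) (hr : 0 ≤ r) (hs : 0 ≤ s)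
    (h1 : p + q + r + s = 1) :
    (s - (r + s) * (q + s)) ^ 2 ≤
      (r + s) * (q + s) * (1 - (r + s)) * (1 - (q + s)) := by
  have e1 : s - (r + s) * (q + s) = p * s - q * r := by
    have : s = s * (p + q + r + s) := by rw [h1, mul_one]
    linear_combination this
  have e2 : 1 - (r + s) = p + q := by linarith
  have e3 : 1 - (q + s) = p + r := by linarith
  rw [e1, e2, e3]
  have h2 : |p * s - q * r| ≤ p * s + q * r := by
    rw [abs_le]
    constructor <;> nlinarith [mul_nonneg hp hs, mul_nonneg hq hr]
  have h3 : p * s + q * r ≤ (r + s) * (p + q) := by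
    nlinarith [mul_nonneg hp hr, mul_nonneg hq hs]
  have h4 : p * s + q * r ≤ (q + s) * (p + r) := by
    nlinarith [mul_nonneg hp hq, mul_nonneg hr hs]
  have h5 : 0 ≤ p * s + q * r := by positivity
  calc (p * s - q * r) ^ 2 = |p * s - q * r| ^ 2 := (sq_abs _).symm
    _ ≤ (p * s + q * r) ^ 2 := by gcongr
    _ = (p * s + q * r) * (p * s + q * r) := sq _
    _ ≤ ((r + s) * (p + q)) * ((q + s) * (p + r)) := by gcongr
    _ = _ := by ring

theorem edgeWeight_mem_Icc (hmsg : M.IsBPFixedPoint msg)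
    (hbelief : ∀ v, 0 < M.vertexBelief msg v 1 ∧ M.vertexBelief msg v 1 < 1)
    {e : Sym2 V} (he : e ∈ G.edgeFinset) :
    0 ≤ M.edgeWeight msg e ∧ M.edgeWeight msg e ≤ 1 := by
  induction e with
  | h u v =>
    have h : G.Adj u v := by simpa using he
    refine ⟨abs_nonneg _, ?_⟩
    simp only [edgeWeight, Sym2.lift_mk]
    have hu := fun x => sum_pairBelief hmsg h x
    have hv := fun x => sum_pairBelief hmsg h.symm x
    have hu1 := sum_vertexBelief (hbelief u).1.ne'
    have hv1 := sum_vertexBelief (hbelief v).1.ne'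
    simp only [Fin.sum_univ_two, M.pairBelief_symm msg v u] at hu hv hu1 hv1
    have hn := pairBelief_nonneg hmsg h
    have hc := covariance_sq_le (hn 0 0) (hn 0 1) (hn 1 0) (hn 1 1)
      (by linarith [hu 0, hu 1])
    rw [hu 1, hv 1] at hc
    have hpos : 0 < M.vertexBelief msg u 1 * M.vertexBelief msg v 1 *
        (1 - M.vertexBelief msg u 1) * (1 - M.vertexBelief msg v 1) :=
      mul_pos (mul_pos (mul_pos (hbelief u).1 (hbelief v).1) (sub_pos.2 (hbelief u).2))
        (sub_pos.2 (hbelief v).2)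
    rw [abs_div, abs_of_nonneg (Real.sqrt_nonneg _), div_le_one (Real.sqrt_pos.2 hpos)]
    exact Real.abs_le_sqrt hc

end Beliefs

section LoopWeight

variable {M : PairwiseMRF G} {msg : V → V → Fin 2 → ℝ}

/-- Each endpoint of an edge receives the factor `√(τ/(1-τ))`; in a loop a covered vertex collects
two of them. -/
theorem edgeWeight_eq (hbelief : ∀ v, 0 < M.vertexBelief msg v 1 ∧ M.vertexBelief msg v 1 < 1)
    {e : Sym2 V} (he : e ∈ G.edgeFinset) :
    M.edgeWeight msg e = |M.edgeLoopFactor msg e| *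
      ∏ v ∈ Finset.univ.filter (fun v => v ∈ e),
        Real.sqrt (M.vertexBelief msg v 1 / (1 - M.vertexBelief msg v 1)) := by
  induction e with
  | h u v =>
    have h : G.Adj u v := by simpa using he
    have hf : Finset.univ.filter (fun x => x ∈ s(u, v)) = {u, v} := by
      ext x; simp
    rw [hf, Finset.prod_pair h.ne]
    simp only [edgeWeight, edgeLoopFactor, Sym2.lift_mk]
    obtain ⟨ha, ha1⟩ := hbelief u
    obtain ⟨hb, hb1⟩ := hbelief v
    generalize M.vertexBelief msg u 1 = a at *
    generalize M.vertexBelief msg v 1 = b at *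
    generalize M.pairBelief msg u v 1 1 = t
    have ha' : 0 < 1 - a := by linarith
    have hb' : 0 < 1 - b := by linarith
    rw [← Real.sqrt_mul (by positivity)]
    have e1 : a / (1 - a) * (b / (1 - b)) = (a * b) ^ 2 / (a * b * (1 - a) * (1 - b)) := by
      field_simp
    have e2 : t / (a * b) - 1 = (t - a * b) / (a * b) := by field_simp
    rw [e1, Real.sqrt_div (by positivity), Real.sqrt_sq (by positivity), e2, abs_div, abs_div,
      abs_of_pos (mul_pos ha hb), abs_of_nonneg (Real.sqrt_nonneg _)]
    field_simp

theorem abs_loopWeight (hbelief : ∀ v, 0 < M.vertexBelief msg v 1 ∧ M.vertexBelief msg v 1 < 1)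
    {F : Finset (Sym2 V)} (hF : F ∈ twoRegularLoops G) :
    |M.loopWeight msg F| = ∏ e ∈ F, M.edgeWeight msg e := by
  rw [twoRegularLoops, Finset.mem_filter, Finset.mem_powerset] at hF
  rw [Finset.prod_congr rfl fun e he => edgeWeight_eq hbelief (hF.1 he), Finset.prod_mul_distrib,
    prod_edges_prod_endpoints, loopWeight, abs_mul, Finset.abs_prod, Finset.abs_prod,
    Finset.prod_filter]
  congr 1
  refine Finset.prod_congr rfl fun v _ => ?_
  obtain ⟨ha, ha1⟩ := hbelief v
  have ha' : 0 < 1 - M.vertexBelief msg v 1 := by linarith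
  by_cases h : subDegree F v = 0
  · simp [h]
  -- In degree two the vertex factor is `τ + τ²/(1-τ) = τ/(1-τ)`, the square of the factor
  -- contributed by each incident edge.
  · rw [if_pos h, hF.2 v h, Real.sq_sqrt (by positivity), abs_of_pos (by norm_num; positivity)]
    norm_num
    field_simp
    ring

theorem stateWeight_eq (hbelief : ∀ v, 0 < M.vertexBelief msg v 1 ∧ M.vertexBelief msg v 1 < 1)
    (F : Finset (Sym2 V)) : M.stateWeight msg F = ∏ e ∈ F, M.edgeWeight msg e := by
  unfold stateWeight
  split_ifs with h
  · exact abs_loopWeight hbelief h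
  · rfl

end LoopWeight

end PairwiseMRF

/-! ### Loops as even subgraphs. -/

section Loops

variable {V : Type*} [Fintype V] [DecidableEq V] {G : SimpleGraph V} [DecidableRel G.Adj]

theorem subDegree_le_degree {F : Finset (Sym2 V)} (hF : F ⊆ G.edgeFinset) (v : V) :
    subDegree F v ≤ G.degree v := by
  rw [← SimpleGraph.card_incidenceFinset_eq_degree, SimpleGraph.incidenceFinset_eq_filter]
  exact Finset.card_le_card (Finset.filter_subset_filter _ hF)

/-- An even degree that is at most three is `0` or `2`. -/
theorem mem_twoRegularLoops_iff (hdeg : G.maxDegree ≤ 3) {F : Finset (Sym2 V)} :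
    F ∈ twoRegularLoops G ↔ F ⊆ G.edgeFinset ∧ oddVertices F = ∅ := by
  rw [twoRegularLoops, Finset.mem_filter, Finset.mem_powerset]
  refine and_congr_right fun hF => ?_
  rw [Finset.eq_empty_iff_forall_notMem]
  refine forall_congr' fun v => ?_
  have h := (subDegree_le_degree hF v).trans ((G.degree_le_maxDegree v).trans hdeg)
  rw [mem_oddVertices, Nat.odd_iff]
  omega

theorem mem_twoOddSubgraphs_iff {F : Finset (Sym2 V)} :
    F ∈ twoOddSubgraphs G ↔ F ⊆ G.edgeFinset ∧ (oddVertices F).card = 2 := by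
  rw [twoOddSubgraphs, Finset.mem_filter, Finset.mem_powerset]

theorem twoRegularLoops_eq_singleton (hn : Fintype.card V ≤ 2) : twoRegularLoops G = {∅} := by
  ext F
  rw [Finset.mem_singleton, twoRegularLoops, Finset.mem_filter, Finset.mem_powerset]
  constructor
  · rintro ⟨hF, h⟩
    by_contra hne
    obtain ⟨e, he⟩ := Finset.nonempty_iff_ne_empty.2 hne
    induction e with
    | h u v =>
      have huv : G.Adj u v := by simpa using hF he
      have hpos : subDegree F u ≠ 0 := by
        unfold subDegree
        rw [Finset.card_ne_zero]
        exact ⟨_, Finset.mem_filter.2 ⟨he, Sym2.mem_mk_left u v⟩⟩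
      have h2 := h u hpos
      have h3 := subDegree_le_degree hF u
      have h4 := G.degree_lt_card_verts u
      omega
  · rintro rfl
    simp [subDegree]

end Loops

end

/-! ### Transition probabilities and detailed balance. -/

noncomputable section

section RealProbabilities

theorem toReal_bind_apply {α β : Type*} [Fintype α] (p : PMF α) (f : α → PMF β) (b : β) :
    (p.bind f b).toReal = ∑ a, (p a).toReal * (f a b).toReal := by
  rw [PMF.bind_apply, tsum_fintype, ENNReal.toReal_sum]
  · simp_rw [ENNReal.toReal_mul]
  · exact fun a _ => ENNReal.mul_ne_top (p.apply_ne_top a) ((f a).apply_ne_top b)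

theorem sum_toReal_eq_one {α : Type*} [Fintype α] (p : PMF α) : ∑ a, (p a).toReal = 1 := by
  rw [← ENNReal.toReal_sum fun a _ => p.apply_ne_top a, ← tsum_fintype (L := .unconditional α), p.tsum_coe,
    ENNReal.toReal_one]

/-- The condition `stay b = 0` makes the formula hold for empty `s` as well, where both sides are
`0`. -/
theorem toReal_pickThen {α β : Type*} [Fintype α] (s : Finset α) (stay : PMF β)
    (f : α → PMF β) (b : β) (hb : stay b = 0) :
    (pickThen s stay f b).toReal = (s.card : ℝ)⁻¹ * ∑ a ∈ s, (f a b).toReal := by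
  classical
  unfold pickThen
  split_ifs with h
  · rw [toReal_bind_apply, Finset.mul_sum, ← Finset.sum_subset (Finset.subset_univ s)]
    · refine Finset.sum_congr rfl fun a ha => ?_
      rw [PMF.uniformOfFinset_apply_of_mem h ha]
      simp
    · intro a _ ha
      rw [PMF.uniformOfFinset_apply_of_notMem h ha]
      simp
  · rw [Finset.not_nonempty_iff_eq_empty] at h
    simp [h, hb]

theorem half_le_toReal_pickThen {α β : Type*} [Fintype α] (s : Finset α) (stay : PMF β)
    (f : α → PMF β) (b : β) (hb : 1 / 2 ≤ (stay b).toReal)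
    (hf : ∀ a, 1 / 2 ≤ (f a b).toReal) : 1 / 2 ≤ (pickThen s stay f b).toReal := by
  unfold pickThen
  split_ifs with h
  · rw [toReal_bind_apply]
    calc (1 / 2 : ℝ) = ∑ a, (PMF.uniformOfFinset s h a).toReal * (1 / 2) := by
          rw [← Finset.sum_mul, sum_toReal_eq_one, one_mul]
      _ ≤ _ := Finset.sum_le_sum fun a _ => mul_le_mul_of_nonneg_left (hf a) ENNReal.toReal_nonneg
  · exact hb

theorem toReal_pure_apply {β : Type*} [DecidableEq β] (a b : β) :
    ((PMF.pure a) b).toReal = if b = a then 1 else 0 := by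
  rw [PMF.pure_apply]
  split_ifs <;> simp_all

theorem toReal_biasedCoin_bind {β : Type*} {p : ℝ} (h0 : 0 ≤ p) (h1 : p ≤ 1)
    (f : Bool → PMF β) (b : β) : ((biasedCoin p h0 h1).bind f b).toReal =
      p * (f true b).toReal + (1 - p) * (f false b).toReal := by
  rw [toReal_bind_apply, Fintype.sum_bool]
  simp [biasedCoin, PMF.ofFintype_apply, ENNReal.toReal_ofReal h0,
    ENNReal.toReal_ofReal (sub_nonneg.2 h1)]

end RealProbabilities

/-- If both endpoints were even, toggling the edge would create four odd vertices. -/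
theorem exists_odd_endpoint {V : Type*} [Fintype V] [DecidableEq V] {G : SimpleGraph V}
    {F : Finset (Sym2 V)} {a b : V} (hab : G.Adj a b)
    (hF2 : (oddVertices F).card = 2) (h2 : IsWormState (F ∆ {s(a, b)})) :
    ∃ v u : V, G.Adj v u ∧ s(u, v) = s(a, b) ∧ v ∈ oddVertices F := by
  by_cases hb : b ∈ oddVertices F
  · exact ⟨b, a, hab.symm, rfl, hb⟩
  by_cases ha : a ∈ oddVertices F
  · exact ⟨a, b, hab, Sym2.eq_swap, ha⟩
  exfalso
  have hcard := card_symmDiff_add (oddVertices F) {a, b}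
  rw [← oddVertices_singleton, ← oddVertices_symmDiff, oddVertices_singleton,
    Finset.card_pair hab.ne] at hcard
  have : oddVertices F ∩ {a, b} = ∅ := by
    rw [Finset.eq_empty_iff_forall_notMem]
    intro x hx
    simp only [Finset.mem_inter, Finset.mem_insert, Finset.mem_singleton] at hx
    obtain ⟨hx, rfl | rfl⟩ := hx <;> contradiction
  rw [this, Finset.card_empty] at hcard
  rcases h2 with h2 | h2 <;> omega

namespace PairwiseMRF

variable {V : Type*} [Fintype V] [DecidableEq V] {G : SimpleGraph V} [DecidableRel G.Adj]
variable (M : PairwiseMRF G) (msg : V → V → Fin 2 → ℝ)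

/-- The transition matrix of the worm chain. -/
def wormKernel (F F' : Finset (Sym2 V)) : ℝ := (M.wormStep msg F F').toReal

/-- The probability of the move `F → F ⊕ {u, v}` in which `v` is picked first. -/
def moveProb (F : Finset (Sym2 V)) (v u : V) : ℝ :=
  if v ∈ (if F ∈ twoRegularLoops G then Finset.univ else oddVertices F) ∧ G.Adj v u then
    ((if F ∈ twoRegularLoops G then Finset.univ else oddVertices F).card : ℝ)⁻¹ *
      ((G.degree v : ℝ)⁻¹ * M.acceptProb msg F v u)
  else 0

/-- The unnormalized stationary measure of the worm chain. -/
def wormMass (F : Finset (Sym2 V)) : ℝ :=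
  if F ∈ twoRegularLoops G then (Fintype.card V : ℝ) ^ 2 * M.stateWeight msg F
  else if F ∈ twoOddSubgraphs G then 4 * M.stateWeight msg F else 0

theorem moveProb_nonneg (F : Finset (Sym2 V)) (v u : V) : 0 ≤ M.moveProb msg F v u := by
  unfold moveProb
  have := M.acceptProb_nonneg msg F v u
  split_ifs <;> positivity

theorem wormMass_nonneg (F : Finset (Sym2 V)) : 0 ≤ M.wormMass msg F := by
  unfold wormMass
  have := M.stateWeight_nonneg msg F
  split_ifs <;> positivity

theorem wormKernel_nonneg (F F' : Finset (Sym2 V)) : 0 ≤ M.wormKernel msg F F' :=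
  ENNReal.toReal_nonneg

theorem sum_wormKernel (F : Finset (Sym2 V)) : ∑ F', M.wormKernel msg F F' = 1 :=
  sum_toReal_eq_one _

theorem half_le_wormKernel_self (F : Finset (Sym2 V)) : 1 / 2 ≤ M.wormKernel msg F F := by
  unfold wormKernel wormStep
  have h : (1 / 2 : ℝ) ≤ ((PMF.pure F) F).toReal := by rw [toReal_pure_apply]; norm_num
  refine half_le_toReal_pickThen _ _ _ _ h fun v => half_le_toReal_pickThen _ _ _ _ h fun u => ?_
  rw [toReal_biasedCoin_bind]
  simp only [toReal_pure_apply]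
  have h1 : M.acceptProb msg F v u ≤ 1 / 2 := min_le_right _ _
  have h2 := M.acceptProb_nonneg msg F v u
  simp only [if_true, Bool.false_eq_true, if_false]
  split_ifs <;> linarith

theorem wormKernel_eq_sum {F F' : Finset (Sym2 V)} (h : F' ≠ F) :
    M.wormKernel msg F F' =
      ∑ v, ∑ u, if F' = F ∆ {s(u, v)} then M.moveProb msg F v u else 0 := by
  have h0 : (PMF.pure F) F' = 0 := by rw [PMF.pure_apply, if_neg h]
  unfold wormKernel wormStep
  rw [toReal_pickThen _ _ _ _ h0, Finset.mul_sum, ← Finset.sum_subset (Finset.subset_univ _)]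
  · refine Finset.sum_congr rfl fun v hv => ?_
    rw [toReal_pickThen _ _ _ _ h0, Finset.mul_sum, Finset.mul_sum,
      ← Finset.sum_subset (Finset.subset_univ (G.neighborFinset v))]
    · refine Finset.sum_congr rfl fun u hu => ?_
      rw [toReal_biasedCoin_bind]
      have hu' : G.Adj v u := by simpa using hu
      simp only [toReal_pure_apply, Bool.false_eq_true, if_false, if_true, if_neg h,
        moveProb, if_pos (And.intro hv hu'), SimpleGraph.card_neighborFinset_eq_degree]
      split_ifs <;> ring
    · intro u _ hu
      have hu' : ¬G.Adj v u := by simpa using hu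
      simp [moveProb, hu']
  · intro v _ hv
    simp [moveProb, hv]

theorem symmDiff_edge_subset_iff {F : Finset (Sym2 V)} {u v : V} (h : G.Adj v u) :
    F ∆ {s(u, v)} ⊆ G.edgeFinset ↔ F ⊆ G.edgeFinset := by
  have key : ∀ F : Finset (Sym2 V), F ⊆ G.edgeFinset → F ∆ {s(u, v)} ⊆ G.edgeFinset := by
    intro F hF e he
    rw [Finset.mem_symmDiff, Finset.mem_singleton] at he
    rcases he with he | he
    · exact hF he.1
    · rw [he.1]; simpa using h.symm
  refine ⟨fun hh => ?_, key F⟩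
  simpa using key _ hh

/-- Clears the Metropolis ratio. States of weight `a = 0` are covered, both sides then being `0`. -/
theorem mul_min_div_half {a b c : ℝ} (ha : 0 ≤ a) (hb : 0 ≤ b) (hc : 0 ≤ c) :
    a * min (c * (b / a)) (1 / 2) = min (c * b) (a / 2) := by
  rcases ha.eq_or_lt with rfl | ha
  · simp only [zero_mul, zero_div]
    exact (min_eq_right (by positivity)).symm
  · rw [mul_min_of_nonneg _ _ ha.le]
    congr 1 <;> field_simp

/-- This flow and that of `wormMass_mul_moveProb_to_even` are the same expression with the two
states exchanged; the masses `n²` and `4` and the coefficients `1/n` and `n/4` are matched for this.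
-/
theorem wormMass_mul_moveProb_even (hdeg : G.maxDegree ≤ 3) {F : Finset (Sym2 V)}
    (hF : F ⊆ G.edgeFinset)
    (h0 : oddVertices F = ∅) {v u : V} (h : G.Adj v u) :
    M.wormMass msg F * M.moveProb msg F v u =
      min (M.stateWeight msg (F ∆ {s(u, v)})) ((Fintype.card V : ℝ) / 2 * M.stateWeight msg F) /
        G.degree v := by
  have hL : F ∈ twoRegularLoops G := (mem_twoRegularLoops_iff hdeg).2 ⟨hF, h0⟩
  have hn : (0 : ℝ) < Fintype.card V := by exact_mod_cast Fintype.card_pos_iff.2 ⟨v⟩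
  have e := mul_min_div_half (M.stateWeight_nonneg msg F)
    (M.stateWeight_nonneg msg (F ∆ {s(u, v)})) (one_div_nonneg.2 hn.le)
  simp only [wormMass, moveProb, acceptProb, acceptCoeff, if_pos hL, h, Finset.mem_univ, and_true,
    if_true, Finset.card_univ]
  calc _ = (Fintype.card V : ℝ) * (M.stateWeight msg F * min (1 / (Fintype.card V : ℝ) *
        (M.stateWeight msg (F ∆ {s(u, v)}) / M.stateWeight msg F)) (1 / 2)) / G.degree v := by
        field_simp
    _ = _ := by
      rw [e, mul_min_of_nonneg _ _ hn.le]
      congr 2 <;> field_simp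

theorem wormMass_mul_moveProb_to_even (hdeg : G.maxDegree ≤ 3) {F : Finset (Sym2 V)}
    (hF : F ⊆ G.edgeFinset)
    (h2 : (oddVertices F).card = 2) {v u : V} (h : G.Adj v u) (hv : v ∈ oddVertices F)
    (h0 : oddVertices (F ∆ {s(u, v)}) = ∅) :
    M.wormMass msg F * M.moveProb msg F v u =
      min ((Fintype.card V : ℝ) / 2 * M.stateWeight msg (F ∆ {s(u, v)})) (M.stateWeight msg F) /
        G.degree v := by
  have hne : oddVertices F ≠ ∅ := fun hh => by simp [hh] at h2
  have hL : F ∉ twoRegularLoops G := fun hh => hne ((mem_twoRegularLoops_iff hdeg).1 hh).2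
  have hO : F ∈ twoOddSubgraphs G := mem_twoOddSubgraphs_iff.2 ⟨hF, h2⟩
  have hL' : F ∆ {s(u, v)} ∈ twoRegularLoops G :=
    (mem_twoRegularLoops_iff hdeg).2 ⟨(symmDiff_edge_subset_iff h).2 hF, h0⟩
  have e := mul_min_div_half (M.stateWeight_nonneg msg F)
    (M.stateWeight_nonneg msg (F ∆ {s(u, v)})) (c := (Fintype.card V : ℝ) / 4) (by positivity)
  simp only [wormMass, moveProb, acceptProb, acceptCoeff, if_neg hL, if_pos hO, if_pos hL', h, hv,
    and_true, if_true, h2]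
  calc _ = 2 * (M.stateWeight msg F * min ((Fintype.card V : ℝ) / 4 *
        (M.stateWeight msg (F ∆ {s(u, v)}) / M.stateWeight msg F)) (1 / 2)) / G.degree v := by
        push_cast; ring
    _ = _ := by
      rw [e, mul_min_of_nonneg _ _ zero_le_two]
      congr 2 <;> ring

theorem wormMass_mul_moveProb_odd (hdeg : G.maxDegree ≤ 3) {F : Finset (Sym2 V)}
    (hF : F ⊆ G.edgeFinset)
    (h2 : (oddVertices F).card = 2) {v u : V} (h : G.Adj v u) (hv : v ∈ oddVertices F)
    (h2' : (oddVertices (F ∆ {s(u, v)})).card = 2) :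
    M.wormMass msg F * M.moveProb msg F v u =
      min (M.stateWeight msg (F ∆ {s(u, v)}) / G.degree u) (M.stateWeight msg F / G.degree v) := by
  have hne : oddVertices F ≠ ∅ := fun hh => by simp [hh] at h2
  have hne' : oddVertices (F ∆ {s(u, v)}) ≠ ∅ := fun hh => by simp [hh] at h2'
  have hL : F ∉ twoRegularLoops G := fun hh => hne ((mem_twoRegularLoops_iff hdeg).1 hh).2
  have hO : F ∈ twoOddSubgraphs G := mem_twoOddSubgraphs_iff.2 ⟨hF, h2⟩
  have hL' : F ∆ {s(u, v)} ∉ twoRegularLoops G :=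
    fun hh => hne' ((mem_twoRegularLoops_iff hdeg).1 hh).2
  have hO' : F ∆ {s(u, v)} ∈ twoOddSubgraphs G :=
    mem_twoOddSubgraphs_iff.2 ⟨(symmDiff_edge_subset_iff h).2 hF, h2'⟩
  have hdv : (0 : ℝ) < G.degree v := by
    exact_mod_cast (G.degree_pos_iff_exists_adj v).2 ⟨u, h⟩
  have e := mul_min_div_half (M.stateWeight_nonneg msg F)
    (M.stateWeight_nonneg msg (F ∆ {s(u, v)})) (c := (G.degree v : ℝ) / (2 * G.degree u))
    (by positivity)
  simp only [wormMass, moveProb, acceptProb, acceptCoeff, if_neg hL, if_pos hO, if_neg hL',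
    if_pos hO', h, hv, and_true, if_true, h2]
  calc _ = 2 / (G.degree v : ℝ) * (M.stateWeight msg F * min ((G.degree v : ℝ) / (2 * G.degree u) *
        (M.stateWeight msg (F ∆ {s(u, v)}) / M.stateWeight msg F)) (1 / 2)) := by
        push_cast; ring
    _ = _ := by
      rw [e, mul_min_of_nonneg _ _ (by positivity)]
      congr 1 <;> field_simp

theorem wormMass_mul_moveProb_eq_zero (hdeg : G.maxDegree ≤ 3) {F : Finset (Sym2 V)} {v u : V}
    (h0 : F ⊆ G.edgeFinset → oddVertices F ≠ ∅)
    (h2 : F ⊆ G.edgeFinset → (oddVertices F).card = 2 → v ∉ oddVertices F) :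
    M.wormMass msg F * M.moveProb msg F v u = 0 := by
  have hL : F ∉ twoRegularLoops G := fun hh => by
    rw [mem_twoRegularLoops_iff hdeg] at hh
    exact h0 hh.1 hh.2
  by_cases hO : F ∈ twoOddSubgraphs G
  · rw [mem_twoOddSubgraphs_iff] at hO
    simp [moveProb, hL, h2 hO.1 hO.2]
  · simp [wormMass, hL, hO]

/-- The defect travels along the edge from `v` to `u`: only `v` can be picked before the move and
only `u` after it. The factor `d(v) / (2 d(u))` compensates the different degrees. -/
theorem wormMass_mul_moveProb_swap_of_odd (hdeg : G.maxDegree ≤ 3) {F : Finset (Sym2 V)}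
    (hF : F ⊆ G.edgeFinset) {v u : V} (h : G.Adj v u)
    (h2 : (oddVertices F).card = 2) (h2' : (oddVertices (F ∆ {s(u, v)})).card = 2)
    (hv : v ∈ oddVertices F) (hu : u ∉ oddVertices F) :
    M.wormMass msg F * (M.moveProb msg F v u + M.moveProb msg F u v) =
      M.wormMass msg (F ∆ {s(u, v)}) *
        (M.moveProb msg (F ∆ {s(u, v)}) v u + M.moveProb msg (F ∆ {s(u, v)}) u v) := by
  have hu' : u ∈ oddVertices (F ∆ {s(u, v)}) := by
    rw [oddVertices_symmDiff, oddVertices_singleton, Finset.mem_symmDiff]; simp [hu]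
  have hv' : v ∉ oddVertices (F ∆ {s(u, v)}) := by
    rw [oddVertices_symmDiff, oddVertices_singleton, Finset.mem_symmDiff]; simp [hv]
  have z1 : M.wormMass msg F * M.moveProb msg F u v = 0 :=
    M.wormMass_mul_moveProb_eq_zero msg hdeg (fun _ hh => by simp [hh] at h2) (fun _ _ => hu)
  have z2 : M.wormMass msg (F ∆ {s(u, v)}) * M.moveProb msg (F ∆ {s(u, v)}) v u = 0 :=
    M.wormMass_mul_moveProb_eq_zero msg hdeg (fun _ hh => by simp [hh] at h2') (fun _ _ => hv')
  have hback : F ∆ {s(u, v)} ∆ {s(v, u)} = F := by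
    rw [Sym2.eq_swap (a := v), symmDiff_symmDiff_cancel_right]
  rw [mul_add, mul_add, z1, z2, M.wormMass_mul_moveProb_odd msg hdeg hF h2 h hv h2',
    M.wormMass_mul_moveProb_odd msg hdeg ((symmDiff_edge_subset_iff h).2 hF) h2' h.symm hu'
      (by rw [hback]; exact h2), hback, min_comm]
  ring

/-- Both endpoints are odd after the move, so the same first vertex can be picked in either
direction and each orientation balances separately. -/
theorem wormMass_mul_moveProb_swap_of_even (hdeg : G.maxDegree ≤ 3) {F : Finset (Sym2 V)}
    (hF : F ⊆ G.edgeFinset) {v u : V} (h : G.Adj v u) (h0 : oddVertices F = ∅) :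
    M.wormMass msg F * (M.moveProb msg F v u + M.moveProb msg F u v) =
      M.wormMass msg (F ∆ {s(u, v)}) *
        (M.moveProb msg (F ∆ {s(u, v)}) v u + M.moveProb msg (F ∆ {s(u, v)}) u v) := by
  have key : ∀ v u, G.Adj v u → M.wormMass msg F * M.moveProb msg F v u =
      M.wormMass msg (F ∆ {s(u, v)}) * M.moveProb msg (F ∆ {s(u, v)}) v u := by
    intro v u h
    rw [M.wormMass_mul_moveProb_even msg hdeg hF h0 h,
      M.wormMass_mul_moveProb_to_even msg hdeg ((symmDiff_edge_subset_iff h).2 hF)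
        (card_oddVertices_symmDiff_of_even h0 h.ne.symm) h
        (by rw [oddVertices_symmDiff, oddVertices_singleton, h0, Finset.mem_symmDiff]; simp)
        (by rw [symmDiff_symmDiff_cancel_right]; exact h0),
      symmDiff_symmDiff_cancel_right, min_comm]
  rw [mul_add, mul_add, key v u h, key u v h.symm, Sym2.eq_swap (a := v)]

theorem wormMass_mul_moveProb_swap (hdeg : G.maxDegree ≤ 3) (F : Finset (Sym2 V)) {v u : V}
    (h : G.Adj v u) :
    M.wormMass msg F * (M.moveProb msg F v u + M.moveProb msg F u v) =
      M.wormMass msg (F ∆ {s(u, v)}) *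
        (M.moveProb msg (F ∆ {s(u, v)}) v u + M.moveProb msg (F ∆ {s(u, v)}) u v) := by
  by_cases hF : F ⊆ G.edgeFinset
  swap
  · have hF' : ¬F ∆ {s(u, v)} ⊆ G.edgeFinset := fun hh => hF ((symmDiff_edge_subset_iff h).1 hh)
    have z : ∀ H : Finset (Sym2 V), ¬H ⊆ G.edgeFinset → ∀ v u,
        M.wormMass msg H * M.moveProb msg H v u = 0 := fun H hH v u =>
      M.wormMass_mul_moveProb_eq_zero msg hdeg (fun hh => absurd hh hH) (fun hh => absurd hh hH)
    rw [mul_add, mul_add, z F hF, z F hF, z _ hF', z _ hF']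
  have hF' : F ∆ {s(u, v)} ⊆ G.edgeFinset := (symmDiff_edge_subset_iff h).2 hF
  by_cases h0 : oddVertices F = ∅
  · exact M.wormMass_mul_moveProb_swap_of_even msg hdeg hF h h0
  by_cases h0' : oddVertices (F ∆ {s(u, v)}) = ∅
  · have := M.wormMass_mul_moveProb_swap_of_even msg hdeg hF' h h0'
    rw [symmDiff_symmDiff_cancel_right] at this
    exact this.symm
  by_cases hb : (oddVertices F).card = 2 ∧ (oddVertices (F ∆ {s(u, v)})).card = 2
  -- Two odd vertices on both sides force the edge to have exactly one odd endpoint, by counting the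
  -- symmetric difference.
  · have hc := card_symmDiff_add (oddVertices F) {u, v}
    rw [← oddVertices_singleton, ← oddVertices_symmDiff, hb.1, hb.2, oddVertices_singleton,
      Finset.card_pair h.ne.symm] at hc
    by_cases hv : v ∈ oddVertices F
    · by_cases hu : u ∈ oddVertices F
      · have : oddVertices F ∩ {u, v} = {u, v} := by
          rw [Finset.inter_eq_right]
          intro x hx
          simp only [Finset.mem_insert, Finset.mem_singleton] at hx
          rcases hx with rfl | rfl <;> assumption
        rw [this, Finset.card_pair h.ne.symm] at hc
        omega
      · exact M.wormMass_mul_moveProb_swap_of_odd msg hdeg hF h hb.1 hb.2 hv hu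
    · by_cases hu : u ∈ oddVertices F
      · have := M.wormMass_mul_moveProb_swap_of_odd msg hdeg hF h.symm hb.1
          (by rw [Sym2.eq_swap]; exact hb.2) hu hv
        rw [Sym2.eq_swap (a := v), add_comm, add_comm (M.moveProb msg (F ∆ {s(u, v)}) u v)] at this
        exact this
      · have : oddVertices F ∩ {u, v} = ∅ := by
          rw [Finset.eq_empty_iff_forall_notMem]
          intro x hx
          simp only [Finset.mem_inter, Finset.mem_insert, Finset.mem_singleton] at hx
          obtain ⟨hx, rfl | rfl⟩ := hx <;> contradiction
        rw [this, Finset.card_empty] at hc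
        omega
  -- In the remaining cases no flow runs along the edge: a state with two odd vertices, toggled at
  -- one of them, would again be a worm state.
  · have z : ∀ H : Finset (Sym2 V), oddVertices H ≠ ∅ → ∀ v u, G.Adj v u →
        oddVertices (H ∆ {s(u, v)}) ≠ ∅ →
        ¬((oddVertices H).card = 2 ∧ (oddVertices (H ∆ {s(u, v)})).card = 2) →
        M.wormMass msg H * M.moveProb msg H v u = 0 := by
      intro H h0 v u h h0' hb
      refine M.wormMass_mul_moveProb_eq_zero msg hdeg (fun _ => h0) fun _ h2 hv => ?_
      have hs := IsWormState.symmDiff_of_mem h2 h.ne.symm hv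
      rw [Sym2.eq_swap] at hs
      rcases hs with hs | hs
      · exact h0' (Finset.card_eq_zero.1 hs)
      · exact hb ⟨h2, hs⟩
    have e : F ∆ {s(u, v)} ∆ {s(u, v)} = F := symmDiff_symmDiff_cancel_right _ _
    have e' : F ∆ {s(u, v)} ∆ {s(v, u)} = F := by rw [Sym2.eq_swap (a := v), e]
    rw [mul_add, mul_add, z F h0 v u h h0' hb,
      z F h0 u v h.symm (by rw [Sym2.eq_swap]; exact h0') (by rw [Sym2.eq_swap]; exact hb),
      z _ h0' v u h (by rw [e]; exact h0) (by rw [e]; tauto),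
      z _ h0' u v h.symm (by rw [e']; exact h0) (by rw [e']; tauto)]

/-- An edge can be proposed from either end, so detailed balance holds only for the sum of both
orientations. -/
theorem two_mul_wormKernel {F F' : Finset (Sym2 V)} (h : F' ≠ F) :
    2 * M.wormKernel msg F F' = ∑ v, ∑ u,
      if F' = F ∆ {s(u, v)} then M.moveProb msg F v u + M.moveProb msg F u v else 0 := by
  have e : M.wormKernel msg F F' =
      ∑ v, ∑ u, if F' = F ∆ {s(u, v)} then M.moveProb msg F u v else 0 := by
    rw [M.wormKernel_eq_sum msg h, Finset.sum_comm]
    simp_rw [fun u v : V => Sym2.eq_swap (a := u) (b := v)]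
  rw [two_mul]
  nth_rewrite 1 [M.wormKernel_eq_sum msg h]
  rw [e]
  simp_rw [← Finset.sum_add_distrib]
  refine Finset.sum_congr rfl fun v _ => Finset.sum_congr rfl fun u _ => ?_
  split_ifs <;> simp

/-- Detailed balance for the worm chain. -/
theorem wormMass_mul_wormKernel (hdeg : G.maxDegree ≤ 3) (F F' : Finset (Sym2 V)) :
    M.wormMass msg F * M.wormKernel msg F F' = M.wormMass msg F' * M.wormKernel msg F' F := by
  by_cases h : F' = F
  · rw [h]
  have key : M.wormMass msg F * (2 * M.wormKernel msg F F') =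
      M.wormMass msg F' * (2 * M.wormKernel msg F' F) := by
    rw [M.two_mul_wormKernel msg h, M.two_mul_wormKernel msg (Ne.symm h)]
    simp_rw [Finset.mul_sum]
    refine Finset.sum_congr rfl fun v _ => Finset.sum_congr rfl fun u _ => ?_
    by_cases hF : F' = F ∆ {s(u, v)}
    · have hF' : F = F' ∆ {s(u, v)} := by rw [hF, symmDiff_symmDiff_cancel_right]
      rw [if_pos hF, if_pos hF']
      by_cases hadj : G.Adj v u
      · rw [M.wormMass_mul_moveProb_swap msg hdeg F hadj, ← hF]
      · have hadj' : ¬G.Adj u v := fun hh => hadj hh.symm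
        simp [moveProb, hadj, hadj']
    · have hF' : F ≠ F' ∆ {s(u, v)} := fun hh => hF (by rw [hh, symmDiff_symmDiff_cancel_right])
      rw [if_neg hF, if_neg hF', mul_zero, mul_zero]
  linarith

theorem moveProb_le_wormKernel (F : Finset (Sym2 V)) (v u : V) :
    M.moveProb msg F v u ≤ M.wormKernel msg F (F ∆ {s(u, v)}) := by
  have hne : F ∆ {s(u, v)} ≠ F := by
    rw [Ne, symmDiff_eq_left]
    exact Finset.singleton_ne_empty _
  rw [M.wormKernel_eq_sum msg hne]
  have h0 : ∀ v' u', 0 ≤ (if F ∆ {s(u, v)} = F ∆ {s(u', v')} then M.moveProb msg F v' u' else 0) := by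
    intro v' u'
    split_ifs
    · exact M.moveProb_nonneg msg _ _ _
    · exact le_rfl
  refine le_trans ?_ (Finset.single_le_sum (fun v' _ => Finset.sum_nonneg fun u' _ => h0 v' u')
    (Finset.mem_univ v))
  refine le_trans ?_ (Finset.single_le_sum (fun u' _ => h0 v u') (Finset.mem_univ u))
  rw [if_pos rfl]

/-- Lower bound on the stationary flow between two worm states that differ in an edge. -/
theorem le_wormMass_mul_wormKernel (hdeg : G.maxDegree ≤ 3) {F : Finset (Sym2 V)}
    (hF : F ⊆ G.edgeFinset) {e : Sym2 V} (he : e ∈ G.edgeFinset) (h1 : IsWormState F)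
    (h2 : IsWormState (F ∆ {e})) {c : ℝ} (hc : c ≤ M.stateWeight msg F)
    (hc' : c ≤ M.stateWeight msg (F ∆ {e})) :
    c ≤ G.maxDegree * (M.wormMass msg F * M.wormKernel msg F (F ∆ {e})) := by
  induction e with
  | h a b =>
  have hab : G.Adj a b := by simpa using he
  suffices ∃ v u : V, G.Adj v u ∧ s(u, v) = s(a, b) ∧
      c / G.maxDegree ≤ M.wormMass msg F * M.moveProb msg F v u by
    obtain ⟨v, u, hvu, hs, hle⟩ := this
    have hΔ : (0 : ℝ) < G.maxDegree := by
      exact_mod_cast ((G.degree_pos_iff_exists_adj v).2 ⟨u, hvu⟩).trans_le (G.degree_le_maxDegree v)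
    rw [← div_le_iff₀' hΔ]
    refine hle.trans (mul_le_mul_of_nonneg_left ?_ (M.wormMass_nonneg msg F))
    rw [← hs]
    exact M.moveProb_le_wormKernel msg F v u
  -- An edge forces `n ≥ 2`, so the factor `n / 2` in the flow formulas only helps the lower bound.
  have hn : (1 : ℝ) ≤ (Fintype.card V : ℝ) / 2 := by
    have : 2 ≤ Fintype.card V := Fintype.one_lt_card_iff.2 ⟨a, b, hab.ne⟩
    have : (2 : ℝ) ≤ Fintype.card V := by exact_mod_cast this
    linarith
  have hgrow : ∀ x, 0 ≤ x → x ≤ (Fintype.card V : ℝ) / 2 * x := fun x hx =>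
    le_mul_of_one_le_left hx hn
  have hW := M.stateWeight_nonneg msg F
  have hW' := M.stateWeight_nonneg msg (F ∆ {s(a, b)})
  have hdiv : ∀ v u : V, G.Adj v u → ∀ x, 0 ≤ x → c ≤ x → c / G.maxDegree ≤ x / G.degree v := by
    intro v u hvu x hx hcx
    have hd := (G.degree_pos_iff_exists_adj v).2 ⟨u, hvu⟩
    have hd' : (0 : ℝ) < G.degree v := by exact_mod_cast hd
    have hle : (G.degree v : ℝ) ≤ G.maxDegree := by exact_mod_cast G.degree_le_maxDegree v
    calc c / G.maxDegree ≤ x / G.maxDegree := by gcongr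
      _ ≤ x / G.degree v := by gcongr
  by_cases h0 : oddVertices F = ∅
  · refine ⟨b, a, hab.symm, rfl, ?_⟩
    rw [M.wormMass_mul_moveProb_even msg hdeg hF h0 hab.symm]
    exact hdiv b a hab.symm _ (le_min hW' (hW.trans (hgrow _ hW))) (le_min hc' (hc.trans (hgrow _ hW)))
  have hF2 : (oddVertices F).card = 2 := h1.resolve_left fun hh => h0 (Finset.card_eq_zero.1 hh)
  obtain ⟨v, u, hvu, hs, hv⟩ := exists_odd_endpoint hab hF2 h2
  refine ⟨v, u, hvu, hs, ?_⟩
  rw [← hs] at h2 hc' hW'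
  by_cases h0' : oddVertices (F ∆ {s(u, v)}) = ∅
  · rw [M.wormMass_mul_moveProb_to_even msg hdeg hF hF2 hvu hv h0']
    exact hdiv v u hvu _ (le_min (hW'.trans (hgrow _ hW')) hW) (le_min (hc'.trans (hgrow _ hW')) hc)
  · have hF2' := h2.resolve_left fun hh => h0' (Finset.card_eq_zero.1 hh)
    rw [M.wormMass_mul_moveProb_odd msg hdeg hF hF2 hvu hv hF2']
    generalize M.stateWeight msg (F ∆ {s(u, v)}) = y at hW' hc' ⊢
    exact le_min (hdiv u v hvu.symm y hW' hc') (hdiv v u hvu _ hW hc)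

end PairwiseMRF

end

/-! ### Canonical paths. -/

noncomputable section

section CanonicalPaths

theorem prod_le_prod_of_subset_of_mem_Icc {α : Type*} [DecidableEq α] {w : α → ℝ} {A B : Finset α}
    (hAB : A ⊆ B) (h0 : ∀ e ∈ B, 0 ≤ w e) (h1 : ∀ e ∈ B, w e ≤ 1) :
    ∏ e ∈ B, w e ≤ ∏ e ∈ A, w e := by
  rw [← Finset.prod_sdiff hAB]
  refine mul_le_of_le_one_left (Finset.prod_nonneg fun e he => h0 e (hAB he)) ?_
  exact Finset.prod_le_one (fun e he => h0 e (Finset.sdiff_subset he))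
    (fun e he => h1 e (Finset.sdiff_subset he))

/-- An element of `D` lies in exactly one of the two sets on either side; outside `D` the set `D'`
changes nothing. -/
theorem prod_mul_prod_symmDiff_of_subset {α : Type*} [DecidableEq α] [Fintype α] (w : α → ℝ)
    (I : Finset α) {D D' : Finset α} (h : D' ⊆ D) :
    (∏ e ∈ I ∆ D', w e) * ∏ e ∈ I ∆ D' ∆ D, w e = (∏ e ∈ I, w e) * ∏ e ∈ I ∆ D, w e := by
  have key : ∀ F : Finset α, ∏ e ∈ F, w e = ∏ e, if e ∈ F then w e else 1 := fun F => by
    rw [Finset.prod_ite_mem, Finset.univ_inter]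
  simp only [key, ← Finset.prod_mul_distrib]
  refine Finset.prod_congr rfl fun e _ => ?_
  have := @h e
  by_cases h1 : e ∈ I <;> by_cases h2 : e ∈ D <;> by_cases h3 : e ∈ D' <;>
    simp_all [Finset.mem_symmDiff]

theorem symmDiff_subset_of_subset {α : Type*} [DecidableEq α] {A B E : Finset α} (hA : A ⊆ E)
    (hB : B ⊆ E) : A ∆ B ⊆ E := by
  intro e he
  rw [Finset.mem_symmDiff] at he
  rcases he with he | he
  · exact hA he.1
  · exact hB he.1

theorem sum_filter_powerset_symmDiff {α : Type*} [DecidableEq α] {E A : Finset α} (hA : A ⊆ E)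
    (p q : Finset α → Prop) [DecidablePred p] [DecidablePred q] (hpq : ∀ F, p F ↔ q (A ∆ F))
    (f : Finset α → ℝ) :
    ∑ F ∈ E.powerset.filter q, f F = ∑ F ∈ E.powerset.filter p, f (A ∆ F) := by
  refine Finset.sum_nbij' (fun F => A ∆ F) (fun F => A ∆ F) ?_ ?_ ?_ ?_ ?_
  · intro F hF
    simp only [Finset.mem_filter, Finset.mem_powerset] at hF ⊢
    refine ⟨symmDiff_subset_of_subset hA hF.1, ?_⟩
    rw [hpq, symmDiff_symmDiff_cancel_left]
    exact hF.2
  · intro F hF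
    simp only [Finset.mem_filter, Finset.mem_powerset] at hF ⊢
    exact ⟨symmDiff_subset_of_subset hA hF.1, (hpq F).1 hF.2⟩
  · intro F _; exact symmDiff_symmDiff_cancel_left _ _
  · intro F _; exact symmDiff_symmDiff_cancel_left _ _
  · intro F _; rw [symmDiff_symmDiff_cancel_left]

variable {V : Type*} [Fintype V] [DecidableEq V]

/-- The relative stationary weight of a worm state with odd-vertex set `S`. -/
def parityCoeff (S : Finset V) : ℝ :=
  (if S = ∅ then (Fintype.card V : ℝ) ^ 2 else 0) + if S.card = 2 then 4 else 0

theorem parityCoeff_nonneg (S : Finset V) : 0 ≤ parityCoeff S := by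
  unfold parityCoeff
  split_ifs <;> positivity

/-- Shifting by `Y` and sorting by `S = oddVertices D` gives sums `Z_{S ∆ oddVertices Y}`, each at
most `Z_∅`. The coefficients add up to `n² + 4 · n(n-1)/2`. -/
theorem sum_parityCoeff_mul_le {E : Finset (Sym2 V)} {w : Sym2 V → ℝ} (h0 : ∀ e ∈ E, 0 ≤ w e)
    (h1 : ∀ e ∈ E, w e ≤ 1) {Y : Finset (Sym2 V)} (hY : Y ⊆ E) :
    ∑ D ∈ E.powerset, parityCoeff (oddVertices D) * ∏ e ∈ Y ∆ D, w e ≤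
      (3 * (Fintype.card V : ℝ) ^ 2 - 2 * Fintype.card V) * parityPoly E w ∅ := by
  have e1 : ∑ D ∈ E.powerset, parityCoeff (oddVertices D) * ∏ e ∈ Y ∆ D, w e =
      ∑ S : Finset V, parityCoeff S * parityPoly E w (S ∆ oddVertices Y) := by
    rw [← Finset.sum_fiberwise E.powerset oddVertices]
    refine Finset.sum_congr rfl fun S _ => ?_
    rw [parityPoly, sum_filter_powerset_symmDiff hY (fun F => oddVertices F = S)
      (fun F => oddVertices F = S ∆ oddVertices Y), Finset.mul_sum]
    · refine Finset.sum_congr rfl fun D hD => ?_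
      rw [(Finset.mem_filter.1 hD).2]
    · intro F
      rw [oddVertices_symmDiff, symmDiff_comm S, symmDiff_right_inj]
  have h2 := sum_two_odd_parity_le E h0 h1 (oddVertices Y)
  have h3 := mul_le_mul_of_nonneg_left (parityPoly_le_empty E h0 h1 (∅ ∆ oddVertices Y))
    (sq_nonneg (Fintype.card V : ℝ))
  rw [e1]
  simp only [parityCoeff, add_mul, Finset.sum_add_distrib, ite_mul, zero_mul,
    Finset.sum_ite_eq', Finset.mem_univ, if_true]
  rw [← Finset.sum_filter, ← Finset.mul_sum]
  linarith

/-- The canonical path estimate for the worm states inside the edge set `E`. -/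
theorem canonical_path_estimate {E : Finset (Sym2 V)} (hE : ∀ e ∈ E, ¬e.IsDiag) {w : Sym2 V → ℝ}
    (h0 : ∀ e ∈ E, 0 ≤ w e) (h1 : ∀ e ∈ E, w e ≤ 1) (f : Finset (Sym2 V) → ℝ) :
    ∑ I ∈ E.powerset, ∑ F ∈ E.powerset.filter (fun F => oddVertices F = ∅),
      parityCoeff (oddVertices I) * (∏ e ∈ I, w e) * (∏ e ∈ F, w e) * (f I - f F) ^ 2 ≤
    E.card * ((3 * (Fintype.card V : ℝ) ^ 2 - 2 * Fintype.card V) * parityPoly E w ∅) *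
      ∑ e ∈ E, ∑ X ∈ E.powerset.filter (fun X => IsWormState X ∧ IsWormState (X ∆ {e})),
        (∏ a ∈ insert e X, w a) * (f X - f (X ∆ {e})) ^ 2 := by
  have hex : ∀ D : Finset (Sym2 V), ∃ pre : Sym2 V → Finset (Sym2 V), D ⊆ E → IsWormState D →
      (∀ e ∈ D, pre e ⊆ D ∧ e ∉ pre e ∧ IsWormState (D ∆ pre e) ∧
        IsWormState (D ∆ pre e ∆ {e})) ∧
      ∀ (f : Finset (Sym2 V) → ℝ) (I : Finset (Sym2 V)),
        f I - f (I ∆ D) = ∑ e ∈ D, (f (I ∆ pre e) - f (I ∆ pre e ∆ {e})) := by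
    intro D
    by_cases h : D ⊆ E ∧ IsWormState D
    · obtain ⟨pre, hpre⟩ := exists_removal_order _ D rfl (fun e he => hE e (h.1 he)) h.2
      exact ⟨pre, fun _ _ => hpre⟩
    · exact ⟨fun _ => ∅, fun a b => absurd ⟨a, b⟩ h⟩
  choose pre hpre using hex
  set W : Finset (Sym2 V) → ℝ := fun F => ∏ e ∈ F, w e with hW
  have hW0 : ∀ F ⊆ E, 0 ≤ W F := fun F hF => Finset.prod_nonneg fun e he => h0 e (hF he)
  set g : Finset (Sym2 V) → Sym2 V → ℝ := fun X e => (f X - f (X ∆ {e})) ^ 2 with hg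
  have hg0 : ∀ X e, 0 ≤ g X e := fun X e => sq_nonneg _
  set St : Sym2 V → Finset (Finset (Sym2 V)) := fun e =>
    E.powerset.filter (fun X => IsWormState X ∧ IsWormState (X ∆ {e})) with hSt
  have hins : ∀ e ∈ E, ∀ X ∈ St e, insert e X ⊆ E := fun e he X hX =>
    Finset.insert_subset he (Finset.mem_powerset.1 (Finset.mem_filter.1 hX).1)
  -- the contribution of all paths with difference `D`
  have hD : ∀ D ∈ E.powerset, IsWormState D →
      ∑ I ∈ E.powerset.filter (fun I => oddVertices I = oddVertices D),
        W I * W (I ∆ D) * (f I - f (I ∆ D)) ^ 2 ≤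
      E.card * ∑ e ∈ E, ∑ X ∈ St e, W (insert e X) * W (insert e X ∆ D) * g X e := by
    intro D hDE hDs
    rw [Finset.mem_powerset] at hDE
    obtain ⟨hp1, hp2⟩ := hpre D hDE hDs
    -- Cauchy–Schwarz on the telescoped path, whose length is at most `E.card`.
    have step1 : ∀ I, (f I - f (I ∆ D)) ^ 2 ≤ E.card * ∑ e ∈ D, g (I ∆ pre D e) e := by
      intro I
      rw [hp2 f I]
      refine sq_sum_le_card_mul_sum_sq.trans ?_
      refine mul_le_mul_of_nonneg_right ?_ (Finset.sum_nonneg fun e _ => hg0 _ _)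
      exact_mod_cast Finset.card_le_card hDE
    -- The encoding: for fixed `D` and `e`, the start `I` is recovered from the current state `X = I
    -- ∆ pre D e`. As `insert e X` is either `X` or `X ∆ {e}`, it arises from `I` by toggling a
    -- subset of `D`, so the product of the weights of the two path ends equals that of `insert e X`
    -- and `insert e X ∆ D`.
    have step2 : ∀ e ∈ D, ∑ I ∈ E.powerset.filter (fun I => oddVertices I = oddVertices D),
        W I * W (I ∆ D) * g (I ∆ pre D e) e ≤
        ∑ X ∈ St e, W (insert e X) * W (insert e X ∆ D) * g X e := by
      intro e he
      obtain ⟨q1, -, q3, q4⟩ := hp1 e he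
      have hsub : E.powerset.filter (fun X => oddVertices X = oddVertices (D ∆ pre D e)) ⊆ St e := by
        intro X hX
        rw [Finset.mem_filter] at hX
        refine Finset.mem_filter.2 ⟨hX.1, (isWormState_congr hX.2).2 q3, ?_⟩
        refine (isWormState_congr ?_).2 q4
        rw [oddVertices_symmDiff, hX.2, oddVertices_symmDiff (D ∆ pre D e)]
      refine le_trans (le_of_eq ?_) (Finset.sum_le_sum_of_subset_of_nonneg hsub ?_)
      · rw [sum_filter_powerset_symmDiff (q1.trans hDE)
          (fun I => oddVertices I = oddVertices D)
          (fun X => oddVertices X = oddVertices (D ∆ pre D e))]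
        · refine Finset.sum_congr rfl fun I _ => ?_
          rw [symmDiff_comm (pre D e) I]
          congr 1
          by_cases hmem : e ∈ I ∆ pre D e
          · rw [Finset.insert_eq_of_mem hmem]
            exact (prod_mul_prod_symmDiff_of_subset w I q1).symm
          · have : insert e (I ∆ pre D e) = I ∆ (pre D e ∆ {e}) := by
              rw [← symmDiff_assoc]
              ext x
              simp only [Finset.mem_insert, Finset.mem_symmDiff (s := I ∆ pre D e),
                Finset.mem_singleton]
              by_cases hx : x = e
              · subst hx; simp [hmem]
              · simp [hx]
            rw [this]
            exact (prod_mul_prod_symmDiff_of_subset w I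
              (symmDiff_subset_of_subset q1 (Finset.singleton_subset_iff.2 he))).symm
        · intro F
          rw [oddVertices_symmDiff, oddVertices_symmDiff, symmDiff_comm (oddVertices D),
            symmDiff_right_inj]
      · intro X hX _
        have hi := hins e (hDE he) X hX
        exact mul_nonneg (mul_nonneg (hW0 _ hi) (hW0 _ (symmDiff_subset_of_subset hi hDE)))
          (hg0 _ _)
    calc _ ≤ ∑ I ∈ E.powerset.filter (fun I => oddVertices I = oddVertices D),
          W I * W (I ∆ D) * (E.card * ∑ e ∈ D, g (I ∆ pre D e) e) := by
          refine Finset.sum_le_sum fun I hI => mul_le_mul_of_nonneg_left (step1 I) ?_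
          have hI' := Finset.mem_powerset.1 (Finset.mem_filter.1 hI).1
          exact mul_nonneg (hW0 _ hI') (hW0 _ (symmDiff_subset_of_subset hI' hDE))
      _ = E.card * ∑ e ∈ D, ∑ I ∈ E.powerset.filter (fun I => oddVertices I = oddVertices D),
          W I * W (I ∆ D) * g (I ∆ pre D e) e := by
          rw [Finset.sum_comm, Finset.mul_sum]
          refine Finset.sum_congr rfl fun I _ => ?_
          rw [← Finset.mul_sum]; ring
      _ ≤ E.card * ∑ e ∈ D, ∑ X ∈ St e, W (insert e X) * W (insert e X ∆ D) * g X e := by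
          gcongr with e he
          exact step2 e he
      _ ≤ _ := by
          refine mul_le_mul_of_nonneg_left ?_ (Nat.cast_nonneg _)
          refine Finset.sum_le_sum_of_subset_of_nonneg hDE fun e he _ =>
            Finset.sum_nonneg fun X hX => ?_
          have hi := hins e he X hX
          exact mul_nonneg (mul_nonneg (hW0 _ hi) (hW0 _ (symmDiff_subset_of_subset hi hDE)))
            (hg0 _ _)
  -- Write `F = I ∆ D`. Then `F` is even exactly when `I` and `D` have the same odd vertices, so the
  -- coefficient can be attached to `D`.
  calc _ = ∑ I ∈ E.powerset, ∑ D ∈ E.powerset.filter (fun D => oddVertices I = oddVertices D),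
        parityCoeff (oddVertices D) * (W I * W (I ∆ D) * (f I - f (I ∆ D)) ^ 2) := by
        refine Finset.sum_congr rfl fun I hI => ?_
        rw [sum_filter_powerset_symmDiff (Finset.mem_powerset.1 hI)
          (fun D => oddVertices I = oddVertices D)]
        · refine Finset.sum_congr rfl fun D hD => ?_
          rw [← (Finset.mem_filter.1 hD).2]; ring
        · intro F
          rw [oddVertices_symmDiff, ← Finset.bot_eq_empty, symmDiff_eq_bot]
    _ = ∑ D ∈ E.powerset, parityCoeff (oddVertices D) *
        ∑ I ∈ E.powerset.filter (fun I => oddVertices I = oddVertices D),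
          W I * W (I ∆ D) * (f I - f (I ∆ D)) ^ 2 := by
        simp_rw [Finset.mul_sum, Finset.sum_filter]
        exact Finset.sum_comm
    _ ≤ ∑ D ∈ E.powerset, parityCoeff (oddVertices D) *
        (E.card * ∑ e ∈ E, ∑ X ∈ St e, W (insert e X) * W (insert e X ∆ D) * g X e) := by
        refine Finset.sum_le_sum fun D hDE => ?_
        by_cases hs : IsWormState D
        · exact mul_le_mul_of_nonneg_left (hD D hDE hs) (parityCoeff_nonneg _)
        · unfold IsWormState at hs
          push Not at hs
          have : parityCoeff (oddVertices D) = 0 := by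
            rw [parityCoeff, if_neg (fun h => hs.1 (by rw [h, Finset.card_empty])), if_neg hs.2,
              add_zero]
          rw [this, zero_mul, zero_mul]
    _ = E.card * ∑ e ∈ E, ∑ X ∈ St e, W (insert e X) * g X e *
        ∑ D ∈ E.powerset, parityCoeff (oddVertices D) * W (insert e X ∆ D) := by
        simp_rw [Finset.mul_sum]
        rw [Finset.sum_comm]
        refine Finset.sum_congr rfl fun e _ => ?_
        rw [Finset.sum_comm]
        refine Finset.sum_congr rfl fun X _ => Finset.sum_congr rfl fun D _ => ?_
        ring
    _ ≤ E.card * ∑ e ∈ E, ∑ X ∈ St e, W (insert e X) * g X e *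
        ((3 * (Fintype.card V : ℝ) ^ 2 - 2 * Fintype.card V) * parityPoly E w ∅) := by
        refine mul_le_mul_of_nonneg_left ?_ (Nat.cast_nonneg _)
        refine Finset.sum_le_sum fun e he => Finset.sum_le_sum fun X hX => ?_
        exact mul_le_mul_of_nonneg_left (sum_parityCoeff_mul_le h0 h1 (hins e he X hX))
          (mul_nonneg (hW0 _ (hins e he X hX)) (hg0 _ _))
    _ = _ := by
        simp_rw [← Finset.sum_mul]
        ring

end CanonicalPaths

end

/-! ### Poincaré inequality and mixing of the worm chain. -/

noncomputable section

namespace PairwiseMRF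

variable {V : Type*} [Fintype V] [DecidableEq V] {G : SimpleGraph V} [DecidableRel G.Adj]

section WormPoincare

variable {M : PairwiseMRF G} {msg : V → V → Fin 2 → ℝ}

theorem stateWeight_empty (M : PairwiseMRF G) (msg : V → V → Fin 2 → ℝ) :
    M.stateWeight msg ∅ = 1 := by
  simp [stateWeight, loopWeight, subDegree]

theorem wormMass_eq (hdeg : G.maxDegree ≤ 3)
    (hbelief : ∀ v, 0 < M.vertexBelief msg v 1 ∧ M.vertexBelief msg v 1 < 1)
    (F : Finset (Sym2 V)) : M.wormMass msg F = if F ∈ G.edgeFinset.powerset then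
      parityCoeff (oddVertices F) * ∏ e ∈ F, M.edgeWeight msg e else 0 := by
  simp only [wormMass, ← stateWeight_eq hbelief, mem_twoRegularLoops_iff hdeg,
    mem_twoOddSubgraphs_iff, Finset.mem_powerset, parityCoeff]
  by_cases hF : F ⊆ G.edgeFinset
  · by_cases h0 : oddVertices F = ∅
    · simp [hF, h0]
    · simp [hF, h0]
  · simp [hF]

theorem sum_wormMass_mul (hdeg : G.maxDegree ≤ 3)
    (hbelief : ∀ v, 0 < M.vertexBelief msg v 1 ∧ M.vertexBelief msg v 1 < 1)
    (h : Finset (Sym2 V) → ℝ) : ∑ F, M.wormMass msg F * h F = ∑ F ∈ G.edgeFinset.powerset,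
      parityCoeff (oddVertices F) * (∏ e ∈ F, M.edgeWeight msg e) * h F := by
  simp_rw [wormMass_eq hdeg hbelief, ite_mul, zero_mul]
  rw [← Finset.sum_filter, Finset.filter_univ_mem]

theorem sum_wormMass_le (hdeg : G.maxDegree ≤ 3) (hmsg : M.IsBPFixedPoint msg)
    (hbelief : ∀ v, 0 < M.vertexBelief msg v 1 ∧ M.vertexBelief msg v 1 < 1) :
    ∑ F, M.wormMass msg F ≤ (3 * (Fintype.card V : ℝ) ^ 2 - 2 * Fintype.card V) *
      parityPoly G.edgeFinset (M.edgeWeight msg) ∅ := by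
  have h := sum_parityCoeff_mul_le (E := G.edgeFinset) (w := M.edgeWeight msg) (Y := ∅)
    (fun e he => (edgeWeight_mem_Icc hmsg hbelief he).1)
    (fun e he => (edgeWeight_mem_Icc hmsg hbelief he).2) (Finset.empty_subset _)
  have h2 := sum_wormMass_mul hdeg hbelief (fun _ => 1)
  simp only [mul_one] at h2
  rw [h2]
  simpa only [← Finset.bot_eq_empty, bot_symmDiff] using h

theorem sum_wormMass_loops (hdeg : G.maxDegree ≤ 3)
    (hbelief : ∀ v, 0 < M.vertexBelief msg v 1 ∧ M.vertexBelief msg v 1 < 1) :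
    ∑ F ∈ twoRegularLoops G, M.wormMass msg F =
      (Fintype.card V : ℝ) ^ 2 * parityPoly G.edgeFinset (M.edgeWeight msg) ∅ := by
  have h : twoRegularLoops G = G.edgeFinset.powerset.filter (fun F => oddVertices F = ∅) := by
    ext F
    rw [mem_twoRegularLoops_iff hdeg, Finset.mem_filter, Finset.mem_powerset]
  rw [parityPoly, ← h, Finset.mul_sum]
  refine Finset.sum_congr rfl fun F hF => ?_
  rw [wormMass, if_pos hF, stateWeight_eq hbelief]

/-- The flow along all edges of `G` is part of the Dirichlet form. -/
theorem sum_edges_le_dirichlet (M : PairwiseMRF G) (msg : V → V → Fin 2 → ℝ)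
    (f : Finset (Sym2 V) → ℝ) (E : Finset (Sym2 V)) (X : Finset (Sym2 V)) :
    ∑ e ∈ E, M.wormMass msg X * M.wormKernel msg X (X ∆ {e}) * (f X - f (X ∆ {e})) ^ 2 ≤
      ∑ Y, M.wormMass msg X * M.wormKernel msg X Y * (f X - f Y) ^ 2 := by
  have hinj : Set.InjOn (fun e : Sym2 V => X ∆ {e}) E := by
    intro a _ b _ hab
    simpa using hab
  rw [← Finset.sum_image (g := fun e : Sym2 V => X ∆ {e})
    (f := fun Y => M.wormMass msg X * M.wormKernel msg X Y * (f X - f Y) ^ 2) hinj]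
  exact Finset.sum_le_sum_of_subset_of_nonneg (Finset.subset_univ _) fun Y _ _ =>
    mul_nonneg (mul_nonneg (M.wormMass_nonneg msg X) (M.wormKernel_nonneg msg X Y)) (sq_nonneg _)

/-- Poincaré inequality for the worm chain. -/
theorem worm_poincare (hdeg : G.maxDegree ≤ 3) (hmsg : M.IsBPFixedPoint msg)
    (hbelief : ∀ v, 0 < M.vertexBelief msg v 1 ∧ M.vertexBelief msg v 1 < 1)
    (f : Finset (Sym2 V) → ℝ) (hf : ∑ F, M.wormMass msg F * f F = 0) :
    ∑ F, M.wormMass msg F * f F ^ 2 ≤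
      6 * G.maxDegree * G.edgeFinset.card * (Fintype.card V : ℝ) ^ 2 *
        ((1 / 2) * ∑ X, ∑ Y, M.wormMass msg X * M.wormKernel msg X Y * (f X - f Y) ^ 2) := by
  set E := G.edgeFinset with hE
  set W : Finset (Sym2 V) → ℝ := fun F => ∏ e ∈ F, M.edgeWeight msg e with hW
  set n : ℝ := (Fintype.card V : ℝ) with hn
  have h0 : ∀ e ∈ E, 0 ≤ M.edgeWeight msg e := fun e he => (edgeWeight_mem_Icc hmsg hbelief he).1
  have h1 : ∀ e ∈ E, M.edgeWeight msg e ≤ 1 := fun e he => (edgeWeight_mem_Icc hmsg hbelief he).2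
  set Z0 := parityPoly E (M.edgeWeight msg) ∅ with hZ0
  have hZpos : 0 < Z0 := zero_lt_one.trans_le (one_le_parityPoly_empty E h0)
  set D := ∑ X, ∑ Y, M.wormMass msg X * M.wormKernel msg X Y * (f X - f Y) ^ 2 with hD
  have hn0 : 0 ≤ n := Nat.cast_nonneg _
  have hpath := canonical_path_estimate (E := E)
    (fun e he => G.not_isDiag_of_mem_edgeFinset he) h0 h1 f
  -- Expanding the square, the cross term vanishes because `f` has mean zero, and the `f F ^ 2` term
  -- is nonnegative and dropped.
  have hlow : Z0 * ∑ F, M.wormMass msg F * f F ^ 2 ≤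
      ∑ I ∈ E.powerset, ∑ F ∈ E.powerset.filter (fun F => oddVertices F = ∅),
      parityCoeff (oddVertices I) * W I * W F * (f I - f F) ^ 2 := by
    have e1 : ∑ I ∈ E.powerset, ∑ F ∈ E.powerset.filter (fun F => oddVertices F = ∅),
        parityCoeff (oddVertices I) * W I * W F * (f I - f F) ^ 2 =
        ∑ F ∈ E.powerset.filter (fun F => oddVertices F = ∅), W F *
          (∑ I, M.wormMass msg I * f I ^ 2 - 2 * f F * ∑ I, M.wormMass msg I * f I +
            f F ^ 2 * ∑ I, M.wormMass msg I * 1) := by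
      rw [Finset.sum_comm]
      refine Finset.sum_congr rfl fun F _ => ?_
      rw [sum_wormMass_mul hdeg hbelief, sum_wormMass_mul hdeg hbelief,
        sum_wormMass_mul hdeg hbelief]
      simp_rw [Finset.mul_sum, ← Finset.sum_sub_distrib, ← Finset.sum_add_distrib, Finset.mul_sum]
      exact Finset.sum_congr rfl fun I _ => by ring
    rw [e1, hf, hZ0, parityPoly, Finset.sum_mul]
    refine Finset.sum_le_sum fun F hF => mul_le_mul_of_nonneg_left ?_ ?_
    · have : 0 ≤ ∑ I, M.wormMass msg I * 1 :=
        Finset.sum_nonneg fun I _ => by rw [mul_one]; exact M.wormMass_nonneg msg I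
      have := mul_nonneg (sq_nonneg (f F)) this
      linarith
    · have hs := Finset.mem_powerset.1 (Finset.mem_filter.1 hF).1
      exact Finset.prod_nonneg fun e he => h0 e (hs he)
  have hflow : ∑ e ∈ E, ∑ X ∈ E.powerset.filter (fun X => IsWormState X ∧ IsWormState (X ∆ {e})),
      W (insert e X) * (f X - f (X ∆ {e})) ^ 2 ≤ G.maxDegree * D := by
    have hle : ∀ e ∈ E, ∀ X ∈ E.powerset.filter
        (fun X => IsWormState X ∧ IsWormState (X ∆ {e})),
        W (insert e X) ≤ G.maxDegree * (M.wormMass msg X * M.wormKernel msg X (X ∆ {e})) := by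
      intro e he X hX
      rw [Finset.mem_filter, Finset.mem_powerset] at hX
      have hi : insert e X ⊆ E := Finset.insert_subset he hX.1
      -- With weights at most `1`, the larger set has the smaller product, so `W (insert e X)` is
      -- below the weights of both ends of the transition.
      have hX' : X ∆ {e} ⊆ insert e X := by
        intro x hx
        rw [Finset.mem_symmDiff, Finset.mem_singleton] at hx
        rw [Finset.mem_insert]
        tauto
      refine M.le_wormMass_mul_wormKernel msg hdeg hX.1 he hX.2.1 hX.2.2 ?_ ?_ <;>
        rw [stateWeight_eq hbelief]
      · exact prod_le_prod_of_subset_of_mem_Icc (Finset.subset_insert _ _)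
          (fun a ha => h0 a (hi ha)) (fun a ha => h1 a (hi ha))
      · exact prod_le_prod_of_subset_of_mem_Icc hX'
          (fun a ha => h0 a (hi ha)) (fun a ha => h1 a (hi ha))
    calc _ ≤ ∑ e ∈ E, ∑ X ∈ E.powerset.filter
          (fun X => IsWormState X ∧ IsWormState (X ∆ {e})),
          G.maxDegree * (M.wormMass msg X * M.wormKernel msg X (X ∆ {e}) *
            (f X - f (X ∆ {e})) ^ 2) := by
          refine Finset.sum_le_sum fun e he => Finset.sum_le_sum fun X hX => ?_
          rw [← mul_assoc]
          exact mul_le_mul_of_nonneg_right (hle e he X hX) (sq_nonneg _)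
      _ ≤ ∑ e ∈ E, ∑ X,
          G.maxDegree * (M.wormMass msg X * M.wormKernel msg X (X ∆ {e}) *
            (f X - f (X ∆ {e})) ^ 2) := by
          refine Finset.sum_le_sum fun e _ =>
            Finset.sum_le_sum_of_subset_of_nonneg (Finset.subset_univ _) fun X _ _ => ?_
          exact mul_nonneg (Nat.cast_nonneg _) (mul_nonneg (mul_nonneg (M.wormMass_nonneg msg X)
            (M.wormKernel_nonneg msg X _)) (sq_nonneg _))
      _ ≤ _ := by
          rw [Finset.sum_comm, hD, Finset.mul_sum]
          refine Finset.sum_le_sum fun X _ => ?_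
          rw [← Finset.mul_sum]
          exact mul_le_mul_of_nonneg_left (sum_edges_le_dirichlet M msg f E X) (Nat.cast_nonneg _)
  have hDnn : 0 ≤ D := Finset.sum_nonneg fun X _ => Finset.sum_nonneg fun Y _ =>
    mul_nonneg (mul_nonneg (M.wormMass_nonneg msg X) (M.wormKernel_nonneg msg X Y)) (sq_nonneg _)
  refine le_of_mul_le_mul_left ?_ hZpos
  have hfl0 : 0 ≤ ∑ e ∈ E, ∑ X ∈ E.powerset.filter
      (fun X => IsWormState X ∧ IsWormState (X ∆ {e})),
      W (insert e X) * (f X - f (X ∆ {e})) ^ 2 :=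
    Finset.sum_nonneg fun e he => Finset.sum_nonneg fun X hX =>
      mul_nonneg (Finset.prod_nonneg fun a ha => h0 a (Finset.insert_subset he
        (Finset.mem_powerset.1 (Finset.mem_filter.1 hX).1) ha)) (sq_nonneg _)
  calc _ ≤ _ := hlow
    _ ≤ _ := hpath
    _ ≤ E.card * (3 * n ^ 2 * Z0) * (G.maxDegree * D) := by
        refine mul_le_mul ?_ hflow hfl0 (by positivity)
        refine mul_le_mul_of_nonneg_left (mul_le_mul_of_nonneg_right ?_ hZpos.le)
          (Nat.cast_nonneg _)
        linarith
    _ = _ := by ring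

/-- Mixing of the worm chain started from the empty subgraph. -/
theorem worm_mixing (hdeg : G.maxDegree ≤ 3) (hmsg : M.IsBPFixedPoint msg)
    (hbelief : ∀ v, 0 < M.vertexBelief msg v 1 ∧ M.vertexBelief msg v 1 < 1)
    (hΔ : 1 ≤ G.maxDegree) (hm : 1 ≤ G.edgeFinset.card) (hV : 1 ≤ Fintype.card V) (T : ℕ) :
    (∑ F, |(M.wormRun msg T F).toReal - M.wormMass msg F / ∑ F', M.wormMass msg F'|) ^ 2 ≤
      (1 - 1 / (6 * G.maxDegree * G.edgeFinset.card * (Fintype.card V : ℝ) ^ 2)) ^ T *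
        (3 * 2 ^ G.edgeFinset.card) := by
  have hΔ' : (1 : ℝ) ≤ G.maxDegree := by exact_mod_cast hΔ
  have hm' : (1 : ℝ) ≤ G.edgeFinset.card := by exact_mod_cast hm
  have hV' : (1 : ℝ) ≤ Fintype.card V := by exact_mod_cast hV
  have hmass : M.wormMass msg ∅ = (Fintype.card V : ℝ) ^ 2 := by
    rw [wormMass, if_pos ((mem_twoRegularLoops_iff hdeg).2
      ⟨Finset.empty_subset _, oddVertices_empty⟩), stateWeight_empty, mul_one]
  have hmpos : 0 < M.wormMass msg ∅ := by rw [hmass]; positivity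
  set Z := ∑ F', M.wormMass msg F' with hZ
  have hZpos : 0 < Z := hmpos.trans_le
    (Finset.single_le_sum (fun F _ => M.wormMass_nonneg msg F) (Finset.mem_univ ∅))
  set C : ℝ := 6 * G.maxDegree * G.edgeFinset.card * (Fintype.card V : ℝ) ^ 2 with hCdef
  have hC : 1 ≤ C := by
    have h1 : (1 : ℝ) ≤ (Fintype.card V : ℝ) ^ 2 := one_le_pow₀ hV'
    have h2 : (1 : ℝ) ≤ 6 * G.maxDegree := by linarith
    exact one_le_mul_of_one_le_of_one_le (one_le_mul_of_one_le_of_one_le h2 hm') h1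
  have h0 : ∀ e ∈ G.edgeFinset, 0 ≤ M.edgeWeight msg e :=
    fun e he => (edgeWeight_mem_Icc hmsg hbelief he).1
  have h1 : ∀ e ∈ G.edgeFinset, M.edgeWeight msg e ≤ 1 :=
    fun e he => (edgeWeight_mem_Icc hmsg hbelief he).2
  have key := sum_abs_sub_stationary_le (ρ := fun F => M.wormMass msg F / Z)
    (P := M.wormKernel msg) (a := ∅) (fun F => div_nonneg (M.wormMass_nonneg msg F) hZpos.le)
    (by rw [← Finset.sum_div]; exact div_self hZpos.ne') (M.wormKernel_nonneg msg)
    (M.sum_wormKernel msg)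
    (fun F F' => by
      rw [div_mul_eq_mul_div, M.wormMass_mul_wormKernel msg hdeg F F', div_mul_eq_mul_div])
    (M.half_le_wormKernel_self msg) hC
    (fun f hf => by
      have hf' : ∑ F, M.wormMass msg F * f F = 0 := by
        simp_rw [div_mul_eq_mul_div, ← Finset.sum_div] at hf
        exact (div_eq_zero_iff.1 hf).resolve_right hZpos.ne'
      have h := div_le_div_of_nonneg_right (worm_poincare hdeg hmsg hbelief f hf') hZpos.le
      simp_rw [div_mul_eq_mul_div, ← Finset.sum_div]
      calc _ ≤ _ := h
        _ = _ := by ring)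
    (div_pos hmpos hZpos) (fun t F => (M.wormRun msg t F).toReal)
    (fun F => by rw [wormRun, toReal_pure_apply])
    (fun t F => by rw [wormRun, toReal_bind_apply]; rfl) T
  refine key.trans ?_
  rw [div_eq_mul_inv]
  refine mul_le_mul_of_nonneg_left ?_ (pow_nonneg ?_ _)
  -- The inverse stationary probability of `∅` is `Z / n² ≤ 3 Z_∅ ≤ 3 · 2^m`.
  · rw [inv_div, div_le_iff₀ hmpos, hmass]
    have hp := parityPoly_le_two_pow G.edgeFinset h0 h1 ∅
    have hp0 := parityPoly_nonneg G.edgeFinset h0 ∅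
    calc Z ≤ _ := sum_wormMass_le hdeg hmsg hbelief
      _ ≤ (3 * (Fintype.card V : ℝ) ^ 2) * parityPoly G.edgeFinset (M.edgeWeight msg) ∅ :=
        mul_le_mul_of_nonneg_right (by linarith) hp0
      _ ≤ (3 * (Fintype.card V : ℝ) ^ 2) * 2 ^ G.edgeFinset.card :=
        mul_le_mul_of_nonneg_left hp (by positivity)
      _ = _ := by ring
  · rw [sub_nonneg, div_le_one (by linarith)]
    exact hC

end WormPoincare

end PairwiseMRF

/-! ### Rejection sampling. -/

section Rejection

theorem sub_le_sum_of_sum_abs_le {α : Type*} [Fintype α] {A : Finset α} (μ ρ : α → ℝ) :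
    ∑ y ∈ A, ρ y - ∑ x, |μ x - ρ x| ≤ ∑ y ∈ A, μ y := by
  have h1 : ∑ y ∈ A, ρ y - ∑ y ∈ A, μ y ≤ ∑ y ∈ A, |μ y - ρ y| := by
    rw [← Finset.sum_sub_distrib]
    refine Finset.sum_le_sum fun y _ => ?_
    rw [abs_sub_comm]
    exact le_abs_self _
  have h2 : ∑ y ∈ A, |μ y - ρ y| ≤ ∑ x, |μ x - ρ x| :=
    Finset.sum_le_sum_of_subset_of_nonneg (Finset.subset_univ A) fun _ _ _ => abs_nonneg _
  linarith

variable {α : Type*} [Fintype α] [DecidableEq α]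

/-- Error of rejection sampling with `N` trials, when one trial has the distribution `μ`. -/
theorem rejection_sampling_error {A : Finset α} {μ ρ τ : α → ℝ} {s : ℕ → α → ℝ}
    (hμ1 : ∑ x, μ x = 1) (hρ1 : ∑ x, ρ x = 1) (hτ0 : ∀ x ∈ A, 0 ≤ τ x) (hτ1 : ∑ x ∈ A, τ x = 1)
    (hτ : ∀ x ∈ A, ρ x = (∑ y ∈ A, ρ y) * τ x) (hp : 0 < ∑ y ∈ A, μ y) (hp1 : ∑ y ∈ A, μ y ≤ 1)
    (hs0 : ∑ x ∈ A, |s 0 x - τ x| ≤ 2)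
    (hs : ∀ N, ∀ x ∈ A, s (N + 1) x = μ x + (1 - ∑ y ∈ A, μ y) * s N x) (N : ℕ) :
    ∑ x ∈ A, |s N x - τ x| ≤
      (∑ x, |μ x - ρ x|) / (∑ y ∈ A, μ y) + 2 * (1 - ∑ y ∈ A, μ y) ^ N := by
  set p := ∑ y ∈ A, μ y with hpdef
  set q := ∑ y ∈ A, ρ y with hqdef
  -- Replacing `ρ = q τ` by `p τ` on `A` costs `|q - p|`, which is paid for by the discrepancy of
  -- `μ` and `ρ` on the complement of `A`. No factor is lost.
  have hB : ∑ x ∈ A, |μ x - p * τ x| ≤ ∑ x, |μ x - ρ x| := by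
    have h1 : ∀ x ∈ A, |μ x - p * τ x| ≤ |μ x - ρ x| + |q - p| * τ x := by
      intro x hx
      have : μ x - p * τ x = (μ x - ρ x) + (q - p) * τ x := by rw [hτ x hx]; ring
      rw [this]
      refine (abs_add_le _ _).trans ?_
      rw [abs_mul, abs_of_nonneg (hτ0 x hx)]
    have h2 : |q - p| ≤ ∑ x ∈ Aᶜ, |μ x - ρ x| := by
      have e1 := Finset.sum_add_sum_compl A μ
      have e2 := Finset.sum_add_sum_compl A ρ
      have : q - p = ∑ x ∈ Aᶜ, (μ x - ρ x) := by
        rw [Finset.sum_sub_distrib]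
        linarith
      rw [this]
      exact Finset.abs_sum_le_sum_abs _ _
    calc _ ≤ ∑ x ∈ A, (|μ x - ρ x| + |q - p| * τ x) := Finset.sum_le_sum h1
      _ = ∑ x ∈ A, |μ x - ρ x| + |q - p| := by
        rw [Finset.sum_add_distrib, ← Finset.mul_sum, hτ1, mul_one]
      _ ≤ ∑ x ∈ A, |μ x - ρ x| + ∑ x ∈ Aᶜ, |μ x - ρ x| := by linarith
      _ = _ := Finset.sum_add_sum_compl A _
  set B := ∑ x, |μ x - ρ x| with hBdef
  have hB0 : 0 ≤ B := Finset.sum_nonneg fun x _ => abs_nonneg _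
  induction N with
  | zero =>
    rw [pow_zero, mul_one]
    have := div_nonneg hB0 hp.le
    linarith
  | succ N ih =>
    have h1 : ∀ x ∈ A, |s (N + 1) x - τ x| ≤ |μ x - p * τ x| + (1 - p) * |s N x - τ x| := by
      intro x hx
      have : s (N + 1) x - τ x = (μ x - p * τ x) + (1 - p) * (s N x - τ x) := by
        rw [hs N x hx]; ring
      rw [this]
      refine (abs_add_le _ _).trans ?_
      rw [abs_mul, abs_of_nonneg (sub_nonneg.2 hp1)]
    calc _ ≤ ∑ x ∈ A, (|μ x - p * τ x| + (1 - p) * |s N x - τ x|) := Finset.sum_le_sum h1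
      _ = ∑ x ∈ A, |μ x - p * τ x| + (1 - p) * ∑ x ∈ A, |s N x - τ x| := by
        rw [Finset.sum_add_distrib, Finset.mul_sum]
      -- The recursion `e ↦ B + (1 - p) e` has the fixed point `B / p`.
      _ ≤ B + (1 - p) * (B / p + 2 * (1 - p) ^ N) := by
        have := mul_le_mul_of_nonneg_left ih (sub_nonneg.2 hp1)
        linarith
      _ = _ := by field_simp; ring

end Rejection

/-! ### The sampler and its numerical bounds. -/

namespace PairwiseMRF

variable {V : Type*} [Fintype V] [DecidableEq V] {G : SimpleGraph V} [DecidableRel G.Adj]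

theorem loopSampler_succ (M : PairwiseMRF G) (msg : V → V → Fin 2 → ℝ) (T N : ℕ)
    {F : Finset (Sym2 V)} (hF : F ∈ twoRegularLoops G) :
    (M.loopSampler msg T (N + 1) F).toReal = (M.wormRun msg T F).toReal +
      (1 - ∑ H ∈ twoRegularLoops G, (M.wormRun msg T H).toReal) *
        (M.loopSampler msg T N F).toReal := by
  have h1 : ∀ H, (M.wormRun msg T H).toReal *
      ((if H ∈ twoRegularLoops G then PMF.pure H else M.loopSampler msg T N) F).toReal =
      (if F = H then (M.wormRun msg T H).toReal else 0) + ((M.wormRun msg T H).toReal -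
        if H ∈ twoRegularLoops G then (M.wormRun msg T H).toReal else 0) *
          (M.loopSampler msg T N F).toReal := by
    intro H
    by_cases hH : H ∈ twoRegularLoops G
    · rw [if_pos hH, if_pos hH, toReal_pure_apply]
      split_ifs <;> ring
    · have : F ≠ H := fun hh => hH (hh ▸ hF)
      rw [if_neg hH, if_neg hH, if_neg this]
      ring
  rw [loopSampler, toReal_bind_apply]
  simp_rw [h1]
  rw [Finset.sum_add_distrib, ← Finset.sum_mul, Finset.sum_sub_distrib, sum_toReal_eq_one,
    Finset.sum_ite_eq, if_pos (Finset.mem_univ F), ← Finset.sum_filter, Finset.filter_univ_mem]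

theorem sum_toReal_le_one {α : Type*} [Fintype α] (p : PMF α) (A : Finset α) :
    ∑ a ∈ A, (p a).toReal ≤ 1 := by
  rw [← sum_toReal_eq_one p]
  exact Finset.sum_le_sum_of_subset_of_nonneg (Finset.subset_univ A)
    fun _ _ _ => ENNReal.toReal_nonneg

theorem empty_mem_twoRegularLoops : ∅ ∈ twoRegularLoops G := by
  simp [twoRegularLoops, subDegree]

theorem loopDistribution_nonneg (M : PairwiseMRF G) (msg : V → V → Fin 2 → ℝ)
    (F : Finset (Sym2 V)) : 0 ≤ M.loopDistribution msg F :=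
  div_nonneg (abs_nonneg _) (Finset.sum_nonneg fun _ _ => abs_nonneg _)

theorem sum_abs_loopWeight_pos (M : PairwiseMRF G) (msg : V → V → Fin 2 → ℝ) :
    0 < ∑ F ∈ twoRegularLoops G, |M.loopWeight msg F| := by
  refine lt_of_lt_of_le ?_ (Finset.single_le_sum (fun F _ => abs_nonneg (M.loopWeight msg F))
    empty_mem_twoRegularLoops)
  simp [loopWeight, subDegree]

theorem sum_loopDistribution (M : PairwiseMRF G) (msg : V → V → Fin 2 → ℝ) :
    ∑ F ∈ twoRegularLoops G, M.loopDistribution msg F = 1 := by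
  simp only [loopDistribution, ← Finset.sum_div]
  exact div_self (M.sum_abs_loopWeight_pos msg).ne'

theorem sum_abs_loopSampler_sub_le_two (M : PairwiseMRF G) (msg : V → V → Fin 2 → ℝ) (T N : ℕ) :
    ∑ F ∈ twoRegularLoops G,
      |(M.loopSampler msg T N F).toReal - M.loopDistribution msg F| ≤ 2 := by
  calc _ ≤ ∑ F ∈ twoRegularLoops G,
        ((M.loopSampler msg T N F).toReal + M.loopDistribution msg F) := by
        refine Finset.sum_le_sum fun F _ => (abs_sub _ _).trans ?_
        rw [abs_of_nonneg ENNReal.toReal_nonneg, abs_of_nonneg (M.loopDistribution_nonneg msg F)]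
    _ ≤ 2 := by
        rw [Finset.sum_add_distrib, sum_loopDistribution]
        linarith [sum_toReal_le_one (M.loopSampler msg T N) (twoRegularLoops G)]

theorem loopSampler_error_eq_zero (M : PairwiseMRF G) (msg : V → V → Fin 2 → ℝ) (T N : ℕ)
    (h : twoRegularLoops G = {∅}) : ∑ F ∈ twoRegularLoops G,
      |(M.loopSampler msg T N F).toReal - M.loopDistribution msg F| = 0 := by
  have h1 : M.loopDistribution msg ∅ = 1 := by
    simpa [h] using M.sum_loopDistribution msg
  have h2 : (M.loopSampler msg T N ∅).toReal = 1 := by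
    induction N with
    | zero => rw [loopSampler, toReal_pure_apply, if_pos rfl]
    | succ N ih =>
      rw [M.loopSampler_succ msg T N empty_mem_twoRegularLoops, ih, h, Finset.sum_singleton]
      ring
  rw [h, Finset.sum_singleton, h1, h2, sub_self, abs_zero]

theorem wormMass_eq_mul_loopDistribution (M : PairwiseMRF G) (msg : V → V → Fin 2 → ℝ)
    {F : Finset (Sym2 V)} (hF : F ∈ twoRegularLoops G) :
    M.wormMass msg F = (∑ H ∈ twoRegularLoops G, M.wormMass msg H) *
      M.loopDistribution msg F := by
  have h : ∀ H ∈ twoRegularLoops G,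
      M.wormMass msg H = (Fintype.card V : ℝ) ^ 2 * |M.loopWeight msg H| := by
    intro H hH
    rw [wormMass, if_pos hH, stateWeight, if_pos hH]
  rw [Finset.sum_congr rfl h, h F hF, ← Finset.mul_sum, loopDistribution]
  have := (M.sum_abs_loopWeight_pos msg).ne'
  field_simp

/-- The loops carry a fraction of at least `n / (3 n - 2)` of the stationary measure. -/
theorem le_sum_wormMass_div {M : PairwiseMRF G} {msg : V → V → Fin 2 → ℝ}
    (hdeg : G.maxDegree ≤ 3) (hmsg : M.IsBPFixedPoint msg)
    (hbelief : ∀ v, 0 < M.vertexBelief msg v 1 ∧ M.vertexBelief msg v 1 < 1)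
    (hV : 1 ≤ Fintype.card V) :
    (Fintype.card V : ℝ) / (3 * Fintype.card V - 2) ≤
      ∑ F ∈ twoRegularLoops G, M.wormMass msg F / ∑ F', M.wormMass msg F' := by
  have hV' : (1 : ℝ) ≤ Fintype.card V := by exact_mod_cast hV
  have h0 : ∀ e ∈ G.edgeFinset, 0 ≤ M.edgeWeight msg e :=
    fun e he => (edgeWeight_mem_Icc hmsg hbelief he).1
  have h1 := one_le_parityPoly_empty G.edgeFinset h0
  have h2 := sum_wormMass_le hdeg hmsg hbelief
  have h3 := sum_wormMass_loops hdeg hbelief (M := M) (msg := msg)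
  have h4 : ∑ F ∈ twoRegularLoops G, M.wormMass msg F ≤ ∑ F, M.wormMass msg F :=
    Finset.sum_le_sum_of_subset_of_nonneg (Finset.subset_univ _)
      fun F _ _ => M.wormMass_nonneg msg F
  rw [← Finset.sum_div, h3]
  rw [h3] at h4
  set Z0 := parityPoly G.edgeFinset (M.edgeWeight msg) ∅
  set n : ℝ := (Fintype.card V : ℝ)
  have hpos : 0 < n ^ 2 * Z0 := by positivity
  rw [div_le_div_iff₀ (by linarith) (hpos.trans_le h4)]
  calc n * ∑ F, M.wormMass msg F ≤ n * ((3 * n ^ 2 - 2 * n) * Z0) := by gcongr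
    _ = _ := by ring

/-- The gap between `n⁴` in `T` and `n²` in the Poincaré constant leaves `(2/3) n² L`, which absorbs
`m log 2 ≤ n²/2` and the other terms. -/
theorem mixing_time_arith {n m Δ L T : ℝ} (hn : 3 ≤ n) (hm : 1 ≤ m) (hm2 : m ≤ n ^ 2 / 2)
    (hΔ : 1 ≤ Δ) (hL : 2 ≤ L) (hT : 4 * Δ * m * n ^ 4 * L ≤ T) :
    Real.log 3 + m * Real.log 2 + 2 * L ≤ T / (6 * Δ * m * n ^ 2) := by
  have h2 : Real.log 2 ≤ 1 := by
    have := Real.log_le_sub_one_of_pos (zero_lt_two : (0 : ℝ) < 2)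
    linarith
  have h3 : Real.log 3 ≤ 2 := by
    have := Real.log_le_sub_one_of_pos (zero_lt_three : (0 : ℝ) < 3)
    linarith
  have hpos : 0 < 6 * Δ * m * n ^ 2 := by positivity
  have h4 : 2 / 3 * n ^ 2 * L ≤ T / (6 * Δ * m * n ^ 2) := by
    rw [le_div_iff₀ hpos]
    calc _ = 4 * Δ * m * n ^ 4 * L := by ring
      _ ≤ T := hT
  have h5 : m * Real.log 2 ≤ m := mul_le_of_le_one_right (by linarith) h2
  have h6 : 9 ≤ n ^ 2 := by nlinarith
  nlinarith [mul_nonneg (sub_nonneg.2 h6) (sub_nonneg.2 hL)]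

theorem success_probability_arith {n : ℝ} (hn : 3 ≤ n) :
    5 / (6 * n) ≤ n / (3 * n - 2) - 1 / (3 * n) := by
  have h : 5 / (6 * n) + 1 / (3 * n) ≤ n / (3 * n - 2) := by
    have e : 5 / (6 * n) + 1 / (3 * n) = 7 / (6 * n) := by field_simp; norm_num
    rw [e, div_le_div_iff₀ (by linarith) (by linarith)]
    nlinarith
  linarith

/-- After the prescribed number of iterations the worm chain is `δ / (3 n)`-close to stationarity. -/
theorem worm_mixing_le {M : PairwiseMRF G} {msg : V → V → Fin 2 → ℝ} (hconn : G.Connected)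
    (hdeg : G.maxDegree ≤ 3) (hmsg : M.IsBPFixedPoint msg)
    (hbelief : ∀ v, 0 < M.vertexBelief msg v 1 ∧ M.vertexBelief msg v 1 < 1)
    (hV : 3 ≤ Fintype.card V) {δ : ℝ} (hδ : 0 < δ) (hδ1 : δ < 1) {T : ℕ}
    (hT : ((G.edgeFinset.card : ℝ) - (Fintype.card V : ℝ) + 1) * Real.log 2 +
        4 * (G.maxDegree : ℝ) * (G.edgeFinset.card : ℝ) * (Fintype.card V : ℝ) ^ 4 *
          Real.log (3 * (Fintype.card V : ℝ) * δ⁻¹) ≤ (T : ℝ)) :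
    ∑ F, |(M.wormRun msg T F).toReal - M.wormMass msg F / ∑ F', M.wormMass msg F'| ≤
      δ / (3 * Fintype.card V) := by
  have hedges : Fintype.card V ≤ G.edgeFinset.card + 1 := by
    have := hconn.card_vert_le_card_edgeSet_add_one
    rwa [Nat.card_eq_fintype_card, Nat.card_eq_fintype_card, ← SimpleGraph.edgeFinset_card] at this
  have hm : 1 ≤ G.edgeFinset.card := by omega
  have hΔ : 1 ≤ G.maxDegree := by
    obtain ⟨e, he⟩ := Finset.card_pos.1 hm
    induction e with
    | h u v =>
      have h : G.Adj u v := by simpa using he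
      exact ((G.degree_pos_iff_exists_adj u).2 ⟨v, h⟩).trans_le (G.degree_le_maxDegree u)
  have hmix := worm_mixing hdeg hmsg hbelief hΔ hm (by omega) T
  set D := ∑ F, |(M.wormRun msg T F).toReal - M.wormMass msg F / ∑ F', M.wormMass msg F'|
  have hn : (3 : ℝ) ≤ Fintype.card V := by exact_mod_cast hV
  have hm' : (1 : ℝ) ≤ G.edgeFinset.card := by exact_mod_cast hm
  have hΔ' : (1 : ℝ) ≤ G.maxDegree := by exact_mod_cast hΔ
  have hedges' : (Fintype.card V : ℝ) ≤ G.edgeFinset.card + 1 := by exact_mod_cast hedges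
  have hm2 : (G.edgeFinset.card : ℝ) ≤ (Fintype.card V : ℝ) ^ 2 / 2 := by
    have h : (G.edgeFinset.card : ℝ) ≤ ((Fintype.card V).choose 2 : ℕ) := by
      exact_mod_cast G.card_edgeFinset_le_card_choose_two
    rw [Nat.cast_choose_two] at h
    nlinarith
  set n : ℝ := (Fintype.card V : ℝ)
  set m : ℝ := (G.edgeFinset.card : ℝ) with hmdef
  set L := Real.log (3 * n * δ⁻¹) with hL
  have hδi : 1 ≤ δ⁻¹ := (one_le_inv₀ hδ).2 hδ1.le
  -- The argument of the logarithm is at least `9 > e²`.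
  have hL2 : 2 ≤ L := by
    rw [hL, Real.le_log_iff_exp_le (by positivity)]
    have h1 : Real.exp 2 = Real.exp 1 * Real.exp 1 := by rw [← Real.exp_add]; norm_num
    have h2 := Real.exp_one_lt_d9
    have h3 := Real.exp_pos 1
    nlinarith
  -- The first term of the bound on `T` is nonnegative, as a connected graph has `m ≥ n - 1`, and is
  -- not needed further.
  have hT' : 4 * (G.maxDegree : ℝ) * m * n ^ 4 * L ≤ T := by
    have : 0 ≤ (m - n + 1) * Real.log 2 :=
      mul_nonneg (by linarith) (Real.log_nonneg one_le_two)
    linarith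
  have harith := mixing_time_arith hn hm' hm2 hΔ' hL2 hT'
  set C : ℝ := 6 * G.maxDegree * m * n ^ 2 with hC
  have hC1 : 1 ≤ C :=
    one_le_mul_of_one_le_of_one_le (one_le_mul_of_one_le_of_one_le (by linarith) hm')
      (one_le_pow₀ (by linarith))
  have hpow : (1 - 1 / C) ^ T ≤ Real.exp (-(T / C)) := by
    have h1 : 1 - 1 / C ≤ Real.exp (-(1 / C)) := by
      have := Real.add_one_le_exp (-(1 / C))
      linarith
    have h2 : 0 ≤ 1 - 1 / C := by rw [sub_nonneg, div_le_one (by linarith)]; exact hC1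
    calc (1 - 1 / C) ^ T ≤ Real.exp (-(1 / C)) ^ T := pow_le_pow_left₀ h2 h1 T
      _ = _ := by rw [← Real.exp_nat_mul]; congr 1; ring
  have hexpL : Real.exp (-L) = δ / (3 * n) := by
    rw [Real.exp_neg, hL, Real.exp_log (by positivity), mul_inv, inv_inv]
    field_simp
  have hsq : D ^ 2 ≤ (δ / (3 * n)) ^ 2 := by
    calc D ^ 2 ≤ _ := hmix
      _ ≤ Real.exp (-(T / C)) * (3 * 2 ^ G.edgeFinset.card) :=
        mul_le_mul_of_nonneg_right hpow (by positivity)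
      _ = Real.exp (-(T / C) + (Real.log 3 + m * Real.log 2)) := by
        rw [Real.exp_add, Real.exp_add, Real.exp_log zero_lt_three, hmdef, Real.exp_nat_mul,
          Real.exp_log zero_lt_two]
      _ ≤ Real.exp (-L + -L) := Real.exp_le_exp.2 (by linarith)
      _ = _ := by rw [Real.exp_add, hexpL, sq]
  exact le_of_sq_le_sq hsq (by positivity)

end PairwiseMRF

end

/-! ### The sampling guarantee. -/

theorem theorem1 {V : Type*} [Fintype V] [DecidableEq V] (G : SimpleGraph V) [DecidableRel G.Adj]
    (hconn : G.Connected) (hdeg : G.maxDegree ≤ 3)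
    (M : PairwiseMRF G) (msg : V → V → Fin 2 → ℝ) (hmsg : M.IsBPFixedPoint msg)
    (hbelief : ∀ v, 0 < M.vertexBelief msg v 1 ∧ M.vertexBelief msg v 1 < 1)
    (δ : ℝ) (hδ : 0 < δ) (N T : ℕ)
    (hN : 1.2 * (Fintype.card V : ℝ) * Real.log (3 * δ⁻¹) ≤ (N : ℝ))
    (hT : ((G.edgeFinset.card : ℝ) - (Fintype.card V : ℝ) + 1) * Real.log 2 +
        4 * (G.maxDegree : ℝ) * (G.edgeFinset.card : ℝ) * (Fintype.card V : ℝ) ^ 4 *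
          Real.log (3 * (Fintype.card V : ℝ) * δ⁻¹) ≤ (T : ℝ)) :
    (1 / 2 : ℝ) * ∑ F ∈ twoRegularLoops G,
      |(M.loopSampler msg T N F).toReal - M.loopDistribution msg F| ≤ δ := by
  rcases le_or_gt 1 δ with hδ1 | hδ1
  · linarith [M.sum_abs_loopSampler_sub_le_two msg T N]
  -- With at most two vertices `∅` is the only loop and the sampler is exact; the numerical
  -- estimates need `n ≥ 3`.
  rcases Nat.lt_or_ge (Fintype.card V) 3 with hV | hV
  · rw [M.loopSampler_error_eq_zero msg T N (twoRegularLoops_eq_singleton (by omega))]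
    linarith
  have hmix := PairwiseMRF.worm_mixing_le hconn hdeg hmsg hbelief hV hδ hδ1 hT
  have hn : (3 : ℝ) ≤ Fintype.card V := by exact_mod_cast hV
  have hq := PairwiseMRF.le_sum_wormMass_div hdeg hmsg hbelief (by omega)
  have hsub := sub_le_sum_of_sum_abs_le (A := twoRegularLoops G)
    (fun F => (M.wormRun msg T F).toReal)
    (fun F => M.wormMass msg F / ∑ F', M.wormMass msg F')
  have harith := PairwiseMRF.success_probability_arith hn
  set ρ : Finset (Sym2 V) → ℝ := fun F => M.wormMass msg F / ∑ F', M.wormMass msg F' with hρ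
  set p := ∑ F ∈ twoRegularLoops G, (M.wormRun msg T F).toReal with hp
  set D := ∑ F, |(M.wormRun msg T F).toReal - ρ F| with hD
  have hn0 : (0 : ℝ) < Fintype.card V := by linarith
  have hDn : D ≤ 1 / (3 * Fintype.card V) :=
    hmix.trans (div_le_div_of_nonneg_right hδ1.le (by positivity))
  have hple : 5 / (6 * (Fintype.card V : ℝ)) ≤ p := by linarith
  have hp0 : 0 < p := lt_of_lt_of_le (by positivity) hple
  have hp1 : p ≤ 1 := PairwiseMRF.sum_toReal_le_one _ _
  have hZpos : 0 < ∑ F', M.wormMass msg F' := by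
    refine (Finset.sum_nonneg fun F _ => M.wormMass_nonneg msg F).lt_of_ne fun h0 => ?_
    have : (0 : ℝ) < (Fintype.card V : ℝ) / (3 * Fintype.card V - 2) :=
      div_pos hn0 (by linarith)
    simp only [hρ, ← h0, div_zero, Finset.sum_const_zero] at hq
    linarith
  have herr := rejection_sampling_error (A := twoRegularLoops G)
    (μ := fun F => (M.wormRun msg T F).toReal) (ρ := ρ) (τ := M.loopDistribution msg)
    (s := fun N F => (M.loopSampler msg T N F).toReal) (sum_toReal_eq_one _)
    (by rw [hρ, ← Finset.sum_div]; exact div_self hZpos.ne')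
    (fun F _ => M.loopDistribution_nonneg msg F) (M.sum_loopDistribution msg)
    (fun F hF => by
      rw [hρ, ← Finset.sum_div, div_mul_eq_mul_div,
        ← M.wormMass_eq_mul_loopDistribution msg hF])
    hp0 hp1 (M.sum_abs_loopSampler_sub_le_two msg T 0)
    (fun N F hF => M.loopSampler_succ msg T N hF) N
  have hfirst : D / p ≤ 2 / 5 * δ := by
    rw [div_le_iff₀ hp0]
    calc D ≤ δ / (3 * Fintype.card V) := hmix
      _ = 2 / 5 * δ * (5 / (6 * (Fintype.card V : ℝ))) := by field_simp; norm_num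
      _ ≤ 2 / 5 * δ * p := mul_le_mul_of_nonneg_left hple (by positivity)
  -- The constant `1.2 = 6/5` cancels `5 / (6n)`, giving `N p ≥ log (3/δ)`.
  have hsecond : (1 - p) ^ N ≤ δ / 3 := by
    have hlog : 0 ≤ Real.log (3 * δ⁻¹) := by
      refine Real.log_nonneg ?_
      have : 1 ≤ δ⁻¹ := (one_le_inv₀ hδ).2 hδ1.le
      linarith
    have hpN : Real.log (3 * δ⁻¹) ≤ N * p := by
      calc Real.log (3 * δ⁻¹) = 1.2 * (Fintype.card V : ℝ) * Real.log (3 * δ⁻¹) *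
            (5 / (6 * (Fintype.card V : ℝ))) := by field_simp; ring
        _ ≤ N * p := mul_le_mul hN hple (by positivity) (Nat.cast_nonneg _)
    calc (1 - p) ^ N ≤ Real.exp (-p) ^ N := by
          refine pow_le_pow_left₀ (by linarith) ?_ N
          have := Real.add_one_le_exp (-p)
          linarith
      _ = Real.exp (-(N * p)) := by rw [← Real.exp_nat_mul]; congr 1; ring
      _ ≤ Real.exp (-Real.log (3 * δ⁻¹)) := Real.exp_le_exp.2 (by linarith)
      _ = δ / 3 := by
        rw [Real.exp_neg, Real.exp_log (by positivity), mul_inv, inv_inv]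
        ring
  -- Half of `2δ/5 + 2δ/3` is `8δ/15`.
  linarith
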